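/- Setting. A target model generates a sequence of tokens over a finite vocabulary by speculative sampling with a pool of $K\ge 2$ drafters. Let $p^t$ and $q_i^t$ be the next-token distributions of the target model and of drafter $i$ at position $t$; the token $x$ drafted by drafter $i$ for position $t$ is drawn from $q_i^t$ and passes verification if $u<\min(1,p^t(x)/q_i^t(x))$ for a fresh uniform variable $u$ on $[0,1]$. In each round one drafter drafts $N_{\max}\ge 1$ tokens; $N_{acc}$ is the number of tokens accepted, that is, the number of leading drafted tokens that pass, and the round yields $N_{acc}+1$ tokens. Put $\alpha_{i,t}=1-d_{TV}(p^t,q_i^t)$ and assume that, for each $i$, the $\alpha_{i,t}$ are drawn i.i.d. (each one independently of everything at the preceding positions) from a distribution $\nu_i$ with mean $\alpha_i$. Let $i^\star$ maximize $\alpha_i$, with $0<\alpha_{i^\star}<1$, and put $\Delta(\alpha_i)=\alpha_{i^\star}-\alpha_i$. The block efficiency (BE) reward of a round of drafter $i$ is $r_i^{BE}=N_{acc}/N_{\max}$; put $\mu_i^{BE}=\mathbb E[r_i^{BE}]$ and $\Delta_i^{BE}=\mu_{i^\star}^{BE}-\mu_i^{BE}$. For a policy $\pi$, which chooses the drafter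 of each round from the drafters and numbers of accepted tokens of the previous rounds, let $\tau(\pi,B)$ be the number of rounds until $B$ tokens have been generated, and let $\mathrm{Reg}(\pi,B)=\mathbb E[\tau(\pi,B)]-\inf_{\pi'}\mathbb E[\tau(\pi',B)]$. MetaSD-UCB with the BE reward, $\pi^{BE}$, uses every drafter once in the first $K$ rounds (which are always performed, so that $\tau(\pi^{BE},B)\ge K$), and after $t\ge K$ rounds it uses a drafter maximizing $\hat\mu_i+\beta\sqrt{2\ln t/n_i}$, where $n_i$ is the number of rounds in which drafter $i$ has been used, $\hat\mu_i$ is the mean of its BE rewards so far, and $\beta=\sqrt{4\mathrm{Var}[r_{i^\star}^{BE}]+2}$. For $n\in\mathbb N$ and $x\in(0,1)$ let $f_n(x)=\frac{x-x^{n+1}}{1-x}$, $g_n(x)=f_n'(x)=\sum_{s=1}^n s x^{s-1}$ and $h_n(x)=\sum_{s=1}^n s\,(x^{s-1}-x^{2n-s})$, and write $n=N_{\max}$. Claim. For given $K$ and $N_{\max}$ there are constants $C,C'>0$ such that, whenever $$h_n(\alpha_{i^\star})\ge\frac{g_n(\alpha_{i^\star})^2}{4n\alpha_{i^\star}}\quad\text{and}\quad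 \mathrm{Var}[r_i^{BE}]<\mathrm{Var}[r_{i^\star}^{BE}]\ \text{ for all } i\ne i^\star,$$ the regret of MetaSD-UCB with the BE reward satisfies, for all integers $B\ge1$, $$\mathrm{Reg}(\pi^{BE},B)\le f(B):=\sum_{i\neq i^\star}\frac{32\,\mathrm{Var}[r_{i^\star}^{BE}]+16}{(\Delta_i^{BE})^2}\Big(\ln B+\ln\ln\sum_{j\ne i^\star}\frac1{(\Delta_j^{BE})^2}+C'\Big)+C,$$ and the leading term of $f$ is strictly larger than that of the bound for the block divergence (BD) reward: $\Delta(\alpha_i)>0$, $\Delta_i^{BE}>0$ and $$\frac{32\,\mathrm{Var}[r_{i^\star}^{BE}]+16}{(\Delta_i^{BE})^2}>\frac{8}{N_{\max}\Delta(\alpha_i)^2}\quad\text{for every } i\ne i^\star,\qquad f(B)>\sum_{i\ne i^\star}\frac{8}{N_{\max}\Delta(\alpha_i)^2}\ln B\quad\text{for every } B\ge1.$$ Consequently the BD-reward regret bound is the tighter one: for any real constants $D,D'$ and all sufficiently large $B$, $$\sum_{i\neq i^\star}\frac{8}{N_{\max}\Delta(\alpha_i)^2}\Big(\ln B+\ln\ln\sum_{j\ne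 i^\star}\frac1{\Delta(\alpha_j)^2}+D'\Big)+D< f(B).$$ -/

import Mathlib

open MeasureTheory ProbabilityTheory Filter

namespace MetaSD

noncomputable section

/-! ### The functions of the acceptance rate -/

/-- `f_n(x) = (x - x^(n+1)) / (1 - x)`. -/
def fFun (n : ℕ) (x : ℝ) : ℝ := (x - x ^ (n + 1)) / (1 - x)

/-- `g_n(x) = ∑_{s=1}^n s x^(s-1)`, the derivative of `f_n`. -/
def gFun (n : ℕ) (x : ℝ) : ℝ := ∑ s ∈ Finset.Icc 1 n, (s : ℝ) * x ^ (s - 1)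

/-- `h_n(x) = ∑_{s=1}^n s (x^(s-1) - x^(2n-s))`. -/
def hFun (n : ℕ) (x : ℝ) : ℝ :=
  ∑ s ∈ Finset.Icc 1 n, (s : ℝ) * (x ^ (s - 1) - x ^ (2 * n - s))

theorem fFun_eq_sum (n : ℕ) {x : ℝ} (hx : x ≠ 1) :
    fFun n x = ∑ s ∈ Finset.Icc 1 n, x ^ s := by
  have h1 : (1 : ℝ) - x ≠ 0 := sub_ne_zero.mpr hx.symm
  unfold fFun
  rw [div_eq_iff h1]
  induction n with
  | zero => simp
  | succ k ih =>
    rw [Finset.sum_Icc_succ_top (by omega), add_mul, ← ih]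
    ring

theorem hasDerivAt_fFun (n : ℕ) {x : ℝ} (hx : x ≠ 1) :
    HasDerivAt (fFun n) (gFun n x) x := by
  have h1 : HasDerivAt (fun y : ℝ => ∑ s ∈ Finset.Icc 1 n, y ^ s) (gFun n x) x := by
    unfold gFun
    exact HasDerivAt.fun_sum fun s _ => hasDerivAt_pow s x
  refine h1.congr_of_eventuallyEq ?_
  filter_upwards [isOpen_ne.mem_nhds hx] with y hy
  exact fFun_eq_sum n hy

/-! ### Speculative sampling with a pool of drafters -/

/-- The random objects of speculative sampling of a sequence of tokens from a vocabulary `V` with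
`K` drafters. Positions of the generated sequence are numbered from `0`. -/
structure SpecSampling (K : ℕ) (V Ω : Type*) [MeasurableSpace Ω] where
  /-- `past t`: all that is determined by the positions before `t`. -/
  past : Filtration ℕ ‹MeasurableSpace Ω›
  /-- `p t ω`: next-token distribution of the target model at position `t`. -/
  p : ℕ → Ω → V → ℝ
  /-- `q i t ω`: next-token distribution of drafter `i` at position `t`. -/
  q : Fin K → ℕ → Ω → V → ℝ
  /-- `tok i t ω`: token drafted by drafter `i` for position `t`. -/
  tok : Fin K → ℕ → Ω → V
  /-- `unif i t ω`: the uniform variable with which that token is verified. -/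
  unif : Fin K → ℕ → Ω → ℝ

namespace SpecSampling

variable {K : ℕ} {V Ω : Type*} [Fintype V] [MeasurableSpace Ω]

/-- The information available to drafter `i` when it drafts the token of position `t`: the past
and the two next-token distributions. -/
@[reducible] def context (S : SpecSampling K V Ω) (i : Fin K) (t : ℕ) : MeasurableSpace Ω :=
  S.past t ⊔ MeasurableSpace.comap (S.p t) inferInstance
    ⊔ MeasurableSpace.comap (S.q i t) inferInstance

/-- The mechanism of speculative sampling: `p` and `q` are probability vectors, the draft token is
drawn from the distribution of the drafter, and the verification variable is uniform on `[0,1]`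
and drawn afresh. -/
structure IsSpecSampling (S : SpecSampling K V Ω) (P : Measure Ω) : Prop where
  p_mem : ∀ t ω, S.p t ω ∈ stdSimplex ℝ V
  q_mem : ∀ i t ω, S.q i t ω ∈ stdSimplex ℝ V
  p_meas : ∀ t, Measurable[S.past (t + 1)] (S.p t)
  q_meas : ∀ i t, Measurable[S.past (t + 1)] (S.q i t)
  tok_meas : ∀ i t v, MeasurableSet[S.past (t + 1)] {ω | S.tok i t ω = v}
  unif_meas : ∀ i t, Measurable[S.past (t + 1)] (S.unif i t)
  tok_law : ∀ i t v,
    P[Set.indicator {ω | S.tok i t ω = v} (fun _ => (1 : ℝ)) | S.context i t]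
      =ᵐ[P] fun ω => S.q i t ω v
  unif_law : ∀ i t, P.map (S.unif i t) = volume.restrict (Set.Icc (0 : ℝ) 1)
  unif_indep : ∀ i t, Indep (MeasurableSpace.comap (S.unif i t) inferInstance)
    (S.context i t ⊔ MeasurableSpace.comap (S.tok i t) ⊤) P

/-- `α_{i,t} = 1 - d_TV(p^t, q_i^t)`, where `d_TV` is half of the `ℓ¹` distance. -/
def alpha (S : SpecSampling K V Ω) (i : Fin K) (t : ℕ) (ω : Ω) : ℝ :=
  1 - (1 / 2) * ∑ v, |S.p t ω v - S.q i t ω v|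

/-- The assumption on model alignment: for every drafter `i` the `α_{i,t}` are drawn i.i.d. from
`ν i`, that is, each `α_{i,t}` has law `ν i` and is independent of the past. -/
structure IsStationary (S : SpecSampling K V Ω) (P : Measure Ω) (ν : Fin K → Measure ℝ) :
    Prop where
  law : ∀ i t, P.map (S.alpha i t) = ν i
  indep : ∀ i t, Indep (MeasurableSpace.comap (S.alpha i t) inferInstance) (S.past t) P

/-- The token drafted by drafter `i` for position `t` passes verification. -/
def Accepted (S : SpecSampling K V Ω) (i : Fin K) (t : ℕ) (ω : Ω) : Prop :=
  S.unif i t ω < min 1 (S.p t ω (S.tok i t ω) / S.q i t ω (S.tok i t ω))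

open Classical in
/-- `N_acc`: the number of accepted tokens in a round of draft length `N` (that is, `N_max`) of
drafter `i` which starts when `l` tokens have been generated, so that its draft tokens are for the
positions `l, …, l + N - 1`. A draft token counts if it and all earlier ones of the round pass. -/
def nAcc (S : SpecSampling K V Ω) (N : ℕ) (i : Fin K) (l : ℕ) (ω : Ω) : ℕ :=
  ((Finset.range N).filter fun j => ∀ k ≤ j, S.Accepted i (l + k) ω).card

/-- The block efficiency reward `N_acc / N_max`. -/
def rBE (S : SpecSampling K V Ω) (N : ℕ) (i : Fin K) (l : ℕ) (ω : Ω) : ℝ :=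
  (S.nAcc N i l ω : ℝ) / N

/-- `μ_i^BE`, the expected BE reward (it does not depend on where the round starts). -/
def meanBE (S : SpecSampling K V Ω) (N : ℕ) (P : Measure Ω) (i : Fin K) : ℝ :=
  ∫ ω, S.rBE N i 0 ω ∂P

/-- `Var[r_i^BE]`, the variance of the BE reward (it does not depend on where the round starts). -/
def varBE (S : SpecSampling K V Ω) (N : ℕ) (P : Measure Ω) (i : Fin K) : ℝ :=
  variance (S.rBE N i 0) P

end SpecSampling

/-! ### Policies, rounds and regret -/

/-- The rounds played so far, in order: the chosen drafter and its number of accepted tokens. -/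
abbrev History (K : ℕ) : Type := List (Fin K × ℕ)

/-- A bandit policy chooses the next drafter from the rounds played so far. -/
abbrev Policy (K : ℕ) : Type := History K → Fin K

/-- Number of tokens generated so far: each round yields its accepted tokens and one more. -/
def tokens {K : ℕ} (H : History K) : ℕ := (H.map fun x => x.2 + 1).sum

/-- Number of rounds in which drafter `i` was chosen. -/
def pulls {K : ℕ} (i : Fin K) (H : History K) : ℕ := (H.filter fun x => x.1 = i).length

/-- Empirical mean of the BE reward of drafter `i`. -/
def empMeanBE {K : ℕ} (N : ℕ) (i : Fin K) (H : History K) : ℝ :=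
  ((H.filter fun x => x.1 = i).map fun x => (x.2 : ℝ) / N).sum / pulls i H

/-- The index of drafter `i` in MetaSD-UCB with the BE reward and exploration parameter `β`. -/
def ucbIndex {K : ℕ} (N : ℕ) (β : ℝ) (i : Fin K) (H : History K) : ℝ :=
  empMeanBE N i H + β * Real.sqrt (2 * Real.log (H.length : ℝ) / pulls i H)

/-- `π` is MetaSD-UCB with the BE reward and exploration parameter `β`: the first `K` rounds use
each drafter once, every later round a drafter of maximal index (ties broken in any way). -/
def IsMetaSDUCB {K : ℕ} (N : ℕ) (β : ℝ) (π : Policy K) : Prop :=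
  (∀ (H : History K) (hH : H.length < K), π H = ⟨H.length, hH⟩) ∧
  ∀ H : History K, K ≤ H.length → ∀ j, ucbIndex N β j H ≤ ucbIndex N β (π H) H

namespace SpecSampling

variable {K : ℕ} {V Ω : Type*} [Fintype V] [MeasurableSpace Ω]

/-- The first `t` rounds of speculative sampling with policy `π`. -/
def history (S : SpecSampling K V Ω) (N : ℕ) (π : Policy K) (ω : Ω) : ℕ → History K
  | 0 => []
  | t + 1 =>
    let H := history S N π ω t
    H ++ [(π H, S.nAcc N (π H) (tokens H) ω)]

/-- Total number of rounds of policy `π` for target length `B`: it stops after the first round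
with at least `B` generated tokens, but not before `m` rounds. For a general policy `m = 0`;
MetaSD-UCB always performs its `K` initial rounds, so there `m = K`. -/
def rounds (S : SpecSampling K V Ω) (N m : ℕ) (π : Policy K) (B : ℕ) (ω : Ω) : ℕ :=
  sInf {t | m ≤ t ∧ B ≤ tokens (S.history N π ω t)}

/-- The expected total number of rounds. -/
def expRounds (S : SpecSampling K V Ω) (P : Measure Ω) (N m : ℕ) (π : Policy K) (B : ℕ) : ℝ :=
  ∫ ω, (S.rounds N m π B ω : ℝ) ∂P

/-- Stopping time regret of MetaSD-UCB, run as `π`, against the optimal policy. -/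
def regretUCB (S : SpecSampling K V Ω) (P : Measure Ω) (N : ℕ) (π : Policy K) (B : ℕ) : ℝ :=
  S.expRounds P N K π B - ⨅ π' : Policy K, S.expRounds P N 0 π' B

end SpecSampling

/-- The common shape of the two regret bounds, with coefficient `c i` of the logarithm and gap
`Δ i` for each suboptimal drafter `i`:
`∑_{i ≠ i⋆} c_i (ln B + ln (ln (∑_{i ≠ i⋆} 1 / Δ_i²)) + C') + C`. -/
def regretBound {K : ℕ} (istar : Fin K) (c Δ : Fin K → ℝ) (C' C : ℝ) (B : ℕ) : ℝ :=
  ∑ i ∈ Finset.univ.erase istar,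
    c i * (Real.log B + Real.log (Real.log (∑ j ∈ Finset.univ.erase istar, 1 / Δ j ^ 2)) + C') + C

end

end MetaSD

namespace MetaSD

/-! Given the past and the distributions `p`, `q`, the token of drafter `i` passes with probability
`∑ v, min (p v) (q v) = α_{i,t}`. Since `α_{i,t}` is independent of the past, it passes with
probability `α_i` given the past alone. A round is thus a truncated geometric trial independent of
all that precedes it: `N_acc ≥ s` has probability `α_i ^ s` for `s ≤ N`. The BE reward therefore has
mean `f_N(α_i) / N` and variance `α_i h_N(α_i) / N ^ 2`.

Regret: rewards lie in `[0,1]`, so Hoeffding's exponential supermartingale makes a confidence bound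
fail after `t` rounds with probability at most `1 / t ^ 2`. While the bounds hold, a suboptimal
drafter is not chosen after the initial rounds once it has `8 β ^ 2 ln B / (Δ_i^BE) ^ 2` uses
(`IsMetaSDUCB.mem_confidenceFailure`), and `8 β ^ 2 = 32 Var + 16`. A Wald argument turns uses into
rounds: with `c = 1 + N μ⋆`, the mean yield of a round of the best drafter, every policy needs at
least `B / c` rounds in expectation, and MetaSD-UCB exceeds this by at most its suboptimal uses and
a constant.

Comparison: convexity of `f_N` gives `Δ_i^BE ≤ g_N(α⋆) Δ(α_i) / N`, and the hypothesis on `h_N` says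
`g_N(α⋆) ^ 2 ≤ 4 N ^ 3 Var`; hence `(Δ_i^BE) ^ 2 ≤ 4 N Var Δ(α_i) ^ 2`. The hypothesis on variances
excludes ties. The iterated logarithm is very negative only if the gaps approach `1`; but `h_N`
vanishes at `1`, so the hypothesis on `h_N` keeps `α⋆`, and with it every BE gap, away from `1`, and
`C'` absorbs the rest. -/

/-! ### Acceptance of a single drafted token -/

theorem measureReal_lt_of_indep_uniform {Ω : Type*} {G m0 : MeasurableSpace Ω} {P : Measure Ω}
    [IsProbabilityMeasure P] (hG : G ≤ m0) {u Y : Ω → ℝ}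
    (hu : Measurable u) (hY : Measurable[G] Y) (hY01 : ∀ ω, Y ω ∈ Set.Icc (0 : ℝ) 1)
    (hlaw : P.map u = volume.restrict (Set.Icc (0 : ℝ) 1))
    (hind : Indep (MeasurableSpace.comap u inferInstance) G P) :
    P.real {ω | u ω < Y ω} = ∫ ω, Y ω ∂P := by
  have hYm : Measurable Y := hY.mono hG le_rfl
  have hi : IndepFun u Y P := by
    rw [IndepFun_iff_Indep]
    exact indep_of_indep_of_le_right hind hY.comap_le
  have hmap := (indepFun_iff_map_prod_eq_prod_map_map hu.aemeasurable hYm.aemeasurable).1 hi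
  have hs : MeasurableSet {z : ℝ × ℝ | z.1 < z.2} := measurableSet_lt measurable_fst measurable_snd
  have h1 : P {ω | u ω < Y ω} = ∫⁻ ω, ENNReal.ofReal (Y ω) ∂P := by
    have h2 : P {ω | u ω < Y ω} = P.map (fun ω => (u ω, Y ω)) {z | z.1 < z.2} := by
      rw [Measure.map_apply (hu.prodMk hYm) hs]; rfl
    have : IsProbabilityMeasure (P.map Y) := Measure.isProbabilityMeasure_map hYm.aemeasurable
    have : IsProbabilityMeasure (P.map u) := Measure.isProbabilityMeasure_map hu.aemeasurable
    rw [h2, hmap, Measure.prod_apply_symm hs,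
      lintegral_map (measurable_measure_prodMk_right hs) hYm]
    refine lintegral_congr fun ω => ?_
    -- Fubini: at a fixed value `y` of `Y` the slice `u < y` meets `[0,1]` in `[0,y)`, of length
    -- `y`.
    have h3 : ((fun x => (x, Y ω)) ⁻¹' {z : ℝ × ℝ | z.1 < z.2}) = Set.Iio (Y ω) := by
      ext x; simp
    rw [h3, hlaw, Measure.restrict_apply measurableSet_Iio]
    have h4 : Set.Iio (Y ω) ∩ Set.Icc 0 1 = Set.Ico 0 (Y ω) := by
      ext x
      have := (hY01 ω).2
      simp only [Set.mem_inter_iff, Set.mem_Iio, Set.mem_Icc, Set.mem_Ico]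
      constructor
      · rintro ⟨a, b, c⟩; exact ⟨b, a⟩
      · rintro ⟨a, b⟩; exact ⟨b, a, by linarith⟩
    rw [h4, Real.volume_Ico, sub_zero]
  rw [measureReal_def, h1, integral_eq_lintegral_of_nonneg_ae
    (ae_of_all _ fun ω => (hY01 ω).1) hYm.aestronglyMeasurable]

namespace SpecSampling

variable {K : ℕ} {V Ω : Type*} [MeasurableSpace Ω]
  {P : Measure Ω} {S : SpecSampling K V Ω} {ν : Fin K → Measure ℝ} {N : ℕ}

theorem measurable_p_context (t : ℕ) (i : Fin K) (v : V) :
    Measurable[S.context i t] fun ω => S.p t ω v :=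
  (measurable_pi_apply v).comp
    ((comap_measurable (S.p t)).mono (le_sup_right.trans le_sup_left) le_rfl)

theorem measurable_q_context (t : ℕ) (i : Fin K) (v : V) :
    Measurable[S.context i t] fun ω => S.q i t ω v :=
  (measurable_pi_apply v).comp ((comap_measurable (S.q i t)).mono le_sup_right le_rfl)

theorem nAcc_le (i : Fin K) (l : ℕ) (ω : Ω) : S.nAcc N i l ω ≤ N := by
  classical
  unfold nAcc
  exact (Finset.card_filter_le _ _).trans (by simp)

/-- The positions counted by `nAcc` form an initial segment, so the count is the length of the
leading run of passes. -/
theorem le_nAcc_iff (i : Fin K) (l : ℕ) (ω : Ω) {s : ℕ} (hs : s ≤ N) :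
    s ≤ S.nAcc N i l ω ↔ ∀ k < s, S.Accepted i (l + k) ω := by
  classical
  unfold nAcc
  constructor
  · intro hc
    by_contra hcon
    push Not at hcon
    obtain ⟨k, hk, hna⟩ := hcon
    have hsub : ((Finset.range N).filter fun j => ∀ k ≤ j, S.Accepted i (l + k) ω)
        ⊆ Finset.range k := by
      intro j hj
      rw [Finset.mem_filter] at hj
      rw [Finset.mem_range]
      by_contra hjk
      exact hna (hj.2 k (not_lt.mp hjk))
    have := Finset.card_le_card hsub
    rw [Finset.card_range] at this
    convert absurd (hc.trans (by convert this)) (by omega)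
  · intro hall
    have hsub : Finset.range s
        ⊆ ((Finset.range N).filter fun j => ∀ k ≤ j, S.Accepted i (l + k) ω) := by
      intro j hj
      rw [Finset.mem_range] at hj
      rw [Finset.mem_filter, Finset.mem_range]
      exact ⟨by omega, fun k hk => hall k (by omega)⟩
    have := Finset.card_le_card hsub
    rw [Finset.card_range] at this
    convert this

variable [Fintype V]

namespace IsSpecSampling

theorem context_le (h : S.IsSpecSampling P) (i : Fin K) (t : ℕ) :
    S.context i t ≤ S.past (t + 1) :=
  sup_le (sup_le (S.past.mono (Nat.le_succ t)) (h.p_meas t).comap_le) (h.q_meas i t).comap_le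

theorem comap_tok_le (h : S.IsSpecSampling P) (i : Fin K) (t : ℕ) :
    MeasurableSpace.comap (S.tok i t) ⊤ ≤ S.past (t + 1) := by
  rintro _ ⟨s, -, rfl⟩
  have : S.tok i t ⁻¹' s = ⋃ v ∈ s, {ω | S.tok i t ω = v} := by ext; simp
  rw [this]
  exact MeasurableSet.biUnion (Set.to_countable s) fun v _ => h.tok_meas i t v

theorem measurable_alpha (h : S.IsSpecSampling P) (i : Fin K) (t : ℕ) :
    Measurable (S.alpha i t) := by
  have hle := (h.context_le i t).trans (S.past.le _)
  have hp : ∀ v, Measurable fun ω => S.p t ω v := fun v =>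
    (measurable_p_context t i v).mono hle le_rfl
  have hq : ∀ v, Measurable fun ω => S.q i t ω v := fun v =>
    (measurable_q_context t i v).mono hle le_rfl
  unfold alpha
  exact measurable_const.sub (measurable_const.mul
    (Finset.measurable_fun_sum _ fun v _ => ((hp v).sub (hq v)).abs))

theorem alpha_eq_sum_min (h : S.IsSpecSampling P) (i : Fin K) (t : ℕ) (ω : Ω) :
    S.alpha i t ω = ∑ v, min (S.p t ω v) (S.q i t ω v) := by
  have h1 : ∀ v, min (S.p t ω v) (S.q i t ω v)
      = (1 / 2) * S.p t ω v + (1 / 2) * S.q i t ω v - (1 / 2) * |S.p t ω v - S.q i t ω v| := by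
    intro v
    rcases le_total (S.p t ω v) (S.q i t ω v) with hv | hv
    · rw [min_eq_left hv, abs_of_nonpos (by linarith)]; ring
    · rw [min_eq_right hv, abs_of_nonneg (by linarith)]; ring
  simp only [h1, Finset.sum_sub_distrib, Finset.sum_add_distrib, ← Finset.mul_sum,
    (h.p_mem t ω).2, (h.q_mem i t ω).2, alpha]
  norm_num

theorem alpha_mem (h : S.IsSpecSampling P) (i : Fin K) (t : ℕ) (ω : Ω) :
    S.alpha i t ω ∈ Set.Icc (0 : ℝ) 1 := by
  constructor
  · rw [h.alpha_eq_sum_min]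
    exact Finset.sum_nonneg fun v _ => le_min ((h.p_mem t ω).1 v) ((h.q_mem i t ω).1 v)
  · unfold alpha
    have : 0 ≤ ∑ v, |S.p t ω v - S.q i t ω v| := Finset.sum_nonneg fun v _ => abs_nonneg _
    linarith

/-- The probability with which a drafted token `v` passes verification. -/
theorem ratio_mem (h : S.IsSpecSampling P) (i : Fin K) (t : ℕ) (ω : Ω) (v : V) :
    min 1 (S.p t ω v / S.q i t ω v) ∈ Set.Icc (0 : ℝ) 1 :=
  ⟨le_min zero_le_one (div_nonneg ((h.p_mem t ω).1 v) ((h.q_mem i t ω).1 v)), min_le_left _ _⟩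

/-- The joint probability of drafting `v` and accepting it. For `q v = 0` both sides vanish,
whatever value the quotient takes. -/
theorem q_mul_ratio (h : S.IsSpecSampling P) (i : Fin K) (t : ℕ) (ω : Ω) (v : V) :
    S.q i t ω v * min 1 (S.p t ω v / S.q i t ω v) = min (S.p t ω v) (S.q i t ω v) := by
  have hp := (h.p_mem t ω).1 v
  rcases eq_or_lt_of_le ((h.q_mem i t ω).1 v) with hq | hq
  · rw [← hq]; simp [hp]
  · rw [mul_min_of_nonneg _ _ hq.le, mul_one, mul_div_cancel₀ _ hq.ne', min_comm]

theorem measurableSet_accepted (h : S.IsSpecSampling P) (i : Fin K) (t : ℕ) :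
    MeasurableSet[S.past (t + 1)] {ω | S.Accepted i t ω} := by
  have h1 : {ω | S.Accepted i t ω} = ⋃ v, ({ω | S.tok i t ω = v} ∩
      {ω | S.unif i t ω < min 1 (S.p t ω v / S.q i t ω v)}) := by
    ext ω; simp [Accepted]
  rw [h1]
  refine MeasurableSet.iUnion fun v => (h.tok_meas i t v).inter ?_
  have hle := h.context_le i t
  have hr : Measurable[S.past (t + 1)] fun ω => min 1 (S.p t ω v / S.q i t ω v) :=
    measurable_const.min (((measurable_p_context t i v).mono hle le_rfl).div
      ((measurable_q_context t i v).mono hle le_rfl))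
  exact @measurableSet_lt ℝ Ω _ _ _ (S.past (t + 1)) _ _ _ _ _ (h.unif_meas i t) hr

variable [IsProbabilityMeasure P]

/-- Tower property: a factor known in the context is pulled out, and `tok_law` replaces the token
indicator by its conditional probability. -/
theorem integral_tok_mul (h : S.IsSpecSampling P) (i : Fin K) (t : ℕ) (v : V) {g : Ω → ℝ}
    (hg : Measurable[S.context i t] g) (hg01 : ∀ ω, g ω ∈ Set.Icc (0 : ℝ) 1) :
    ∫ ω, Set.indicator {ω | S.tok i t ω = v} (fun _ => (1 : ℝ)) ω * g ω ∂P
      = ∫ ω, S.q i t ω v * g ω ∂P := by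
  have hle := (h.context_le i t).trans (S.past.le _)
  have hm : MeasurableSet {ω | S.tok i t ω = v} := S.past.le _ _ (h.tok_meas i t v)
  have hi : Integrable (Set.indicator {ω | S.tok i t ω = v} (fun _ => (1 : ℝ))) P :=
    (integrable_const 1).indicator hm
  have hgb : ∀ᵐ ω ∂P, ‖g ω‖ ≤ 1 := ae_of_all _ fun ω => by
    rw [Real.norm_eq_abs, abs_of_nonneg (hg01 ω).1]; exact (hg01 ω).2
  have hig : Integrable (Set.indicator {ω | S.tok i t ω = v} (fun _ => (1 : ℝ)) * g) P :=
    hi.mul_bdd (c := 1) (hg.mono hle le_rfl).aestronglyMeasurable hgb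
  have h1 := condExp_mul_of_stronglyMeasurable_right (μ := P) hg.stronglyMeasurable hig hi
  rw [← integral_condExp hle] 
  refine integral_congr_ae ?_
  refine h1.trans ?_
  filter_upwards [h.tok_law i t v] with ω hω
  simp only [Pi.mul_apply]
  rw [hω]

/-- Integrating out the uniform variable leaves the acceptance ratio at the drafted token;
integrating out the token leaves `∑ v, q v * min 1 (p v / q v) = α_{i,t}`. -/
theorem measureReal_inter_accepted_eq_setIntegral (h : S.IsSpecSampling P) (i : Fin K) (t : ℕ)
    {E : Set Ω} (hE : MeasurableSet[S.past t] E) :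
    P.real (E ∩ {ω | S.Accepted i t ω}) = ∫ ω in E, S.alpha i t ω ∂P := by
  classical
  have hle := (h.context_le i t).trans (S.past.le _)
  have hEc : MeasurableSet[S.context i t] E := (le_sup_left.trans le_sup_left : _ ≤ S.context i t) _ hE
  have hEm : MeasurableSet E := hle _ hEc
  -- The indicator of `E` goes into the threshold, so that `E` and acceptance become the single
  -- comparison `unif < Y`. Off `E` this reads `unif < 0`, which is null by `h0`.
  let a : V → Ω → ℝ := fun v => E.indicator fun ω => min 1 (S.p t ω v / S.q i t ω v)
  have ha : ∀ v, Measurable[S.context i t] (a v) := fun v =>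
    Measurable.indicator (measurable_const.min
      ((measurable_p_context t i v).div (measurable_q_context t i v))) hEc
  have ha01 : ∀ v ω, a v ω ∈ Set.Icc (0 : ℝ) 1 := by
    intro v ω
    by_cases hω : ω ∈ E
    · simpa [a, hω] using h.ratio_mem i t ω v
    · simp [a, hω]
  let Y : Ω → ℝ := fun ω => a (S.tok i t ω) ω
  have hY : ∀ ω, Y ω = ∑ v, Set.indicator {ω | S.tok i t ω = v} (fun _ => (1 : ℝ)) ω * a v ω := by
    intro ω
    rw [Finset.sum_eq_single (S.tok i t ω)]
    · simp [Y]
    · intro v _ hv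
      rw [Set.indicator_of_notMem (by simpa using hv.symm), zero_mul]
    · simp
  have hG : S.context i t ⊔ MeasurableSpace.comap (S.tok i t) ⊤ ≤ ‹MeasurableSpace Ω› :=
    sup_le hle ((h.comap_tok_le i t).trans (S.past.le _))
  have hYm : Measurable[S.context i t ⊔ MeasurableSpace.comap (S.tok i t) ⊤] Y := by
    rw [funext hY]
    refine Finset.measurable_fun_sum _ fun v _ => Measurable.mul ?_ ((ha v).mono le_sup_left le_rfl)
    refine Measurable.indicator measurable_const ?_
    exact (le_sup_right : _ ≤ S.context i t ⊔ MeasurableSpace.comap (S.tok i t) ⊤) _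
      ⟨{v}, trivial, by ext; simp⟩
  have hu : Measurable (S.unif i t) := (h.unif_meas i t).mono (S.past.le _) le_rfl
  have h0 : ∀ᵐ ω ∂P, 0 ≤ S.unif i t ω := by
    have : ∀ᵐ x ∂(P.map (S.unif i t)), 0 ≤ x := by
      rw [h.unif_law i t]
      filter_upwards [ae_restrict_mem measurableSet_Icc] with x hx using hx.1
    exact ae_of_ae_map hu.aemeasurable this
  have h1 : P.real (E ∩ {ω | S.Accepted i t ω}) = P.real {ω | S.unif i t ω < Y ω} := by
    refine measureReal_congr ?_
    filter_upwards [h0] with ω hω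
    refine propext ?_
    change (ω ∈ E ∧ S.Accepted i t ω) ↔ S.unif i t ω < Y ω
    by_cases hωE : ω ∈ E
    · simp [Y, a, hωE, Accepted]
    · simp [Y, a, hωE, hω]
  have hint : ∀ v, Integrable (fun ω => S.q i t ω v * a v ω) P := by
    intro v
    refine Integrable.of_bound (C := 1) ((((measurable_q_context t i v).mul (ha v)).mono hle
      le_rfl).aestronglyMeasurable) (ae_of_all _ fun ω => ?_)
    have hq0 := (h.q_mem i t ω).1 v
    have hq1 : S.q i t ω v ≤ 1 := by
      rw [← (h.q_mem i t ω).2]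
      exact Finset.single_le_sum (f := S.q i t ω) (fun w _ => (h.q_mem i t ω).1 w)
        (Finset.mem_univ v)
    rw [Real.norm_eq_abs, abs_of_nonneg (mul_nonneg hq0 (ha01 v ω).1)]
    exact mul_le_one₀ hq1 (ha01 v ω).1 (ha01 v ω).2
  rw [h1, measureReal_lt_of_indep_uniform hG hu hYm (fun ω => ha01 _ ω) (h.unif_law i t)
    (h.unif_indep i t)]
  rw [funext hY, integral_finsetSum]
  · simp_rw [h.integral_tok_mul i t _ (ha _) (ha01 _)]
    rw [← integral_finsetSum _ fun v _ => hint v, ← integral_indicator hEm]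
    congr 1
    ext ω
    by_cases hω : ω ∈ E
    · simp [a, hω, h.q_mul_ratio, h.alpha_eq_sum_min]
    · simp [a, hω]
  · intro v _
    refine Integrable.bdd_mul (c := 1) ?_ ?_ (ae_of_all _ fun ω => ?_)
    · exact Integrable.of_bound (C := 1) ((ha v).mono hle le_rfl).aestronglyMeasurable
        (ae_of_all _ fun ω => by
          rw [Real.norm_eq_abs, abs_of_nonneg (ha01 v ω).1]; exact (ha01 v ω).2)
    · exact (measurable_const.indicator (S.past.le _ _ (h.tok_meas i t v))).aestronglyMeasurable
    · exact norm_indicator_le_norm_self _ _ |>.trans (by simp)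

end IsSpecSampling

/-- Each drafted token passes with probability `α_i`, independently of the past. -/
theorem IsStationary.measureReal_inter_accepted [IsProbabilityMeasure P]
    (hst : S.IsStationary P ν) (h : S.IsSpecSampling P) (i : Fin K) (t : ℕ)
    {E : Set Ω} (hE : MeasurableSet[S.past t] E) :
    P.real (E ∩ {ω | S.Accepted i t ω}) = P.real E * ∫ x, x ∂(ν i) := by
  have hm := h.measurable_alpha i t
  have hEm : MeasurableSet E := S.past.le _ _ hE
  have hEi : Measurable[S.past t] (E.indicator fun _ => (1 : ℝ)) :=
    Measurable.indicator (m := S.past t) measurable_const hE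
  have hind : IndepFun (E.indicator fun _ => (1 : ℝ)) (S.alpha i t) P := by
    rw [IndepFun_iff_Indep]
    exact indep_of_indep_of_le_left (hst.indep i t).symm hEi.comap_le
  rw [h.measureReal_inter_accepted_eq_setIntegral i t hE, ← hst.law i t,
    integral_map hm.aemeasurable (f := fun x : ℝ => x) aestronglyMeasurable_id, ← integral_indicator hEm]
  have h1 : E.indicator (S.alpha i t)
      = fun ω => (E.indicator fun _ => (1 : ℝ)) ω * S.alpha i t ω := by
    ext ω
    by_cases hω : ω ∈ E <;> simp [hω]
  rw [h1, hind.integral_fun_mul_eq_mul_integral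
    (measurable_const.indicator hEm).aestronglyMeasurable hm.aestronglyMeasurable]
  congr 1
  rw [integral_indicator hEm]
  simp

/-! ### Law of the number of accepted tokens -/

namespace IsSpecSampling

theorem measurableSet_le_nAcc (h : S.IsSpecSampling P) (i : Fin K) (l s : ℕ) :
    MeasurableSet[S.past (l + s)] {ω | s ≤ S.nAcc N i l ω} := by
  by_cases hs : s ≤ N
  · have : {ω | s ≤ S.nAcc N i l ω} = ⋂ k ∈ Set.Iio s, {ω | S.Accepted i (l + k) ω} := by
      ext ω
      simp [le_nAcc_iff i l ω hs]
    rw [this]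
    refine MeasurableSet.biInter (Set.to_countable _) fun k hk => ?_
    have hk' : k < s := hk
    exact S.past.mono (by omega : l + k + 1 ≤ l + s) _ (h.measurableSet_accepted i (l + k))
  · have : {ω | s ≤ S.nAcc N i l ω} = ∅ := by
      ext ω
      have := nAcc_le (S := S) (N := N) i l ω
      simp only [Set.mem_ofPred_eq, Set.mem_empty_iff_false, iff_false]
      omega
    rw [this]
    exact @MeasurableSet.empty _ (S.past (l + s))

/-- Deciding that exactly `n` tokens pass takes position `l + n` as well. The resulting time `l + n
+ 1` is where the next round starts, which keeps histories adapted. -/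
theorem measurableSet_nAcc_eq (h : S.IsSpecSampling P) (i : Fin K) (l n : ℕ) :
    MeasurableSet[S.past (l + n + 1)] {ω | S.nAcc N i l ω = n} := by
  have : {ω | S.nAcc N i l ω = n}
      = {ω | n ≤ S.nAcc N i l ω} \ {ω | n + 1 ≤ S.nAcc N i l ω} := by
    ext ω
    simp only [Set.mem_ofPred_eq, Set.mem_sdiff]
    omega
  rw [this]
  exact (S.past.mono (by omega : l + n ≤ l + n + 1) _ (h.measurableSet_le_nAcc i l n)).diff
    (h.measurableSet_le_nAcc i l (n + 1))

theorem measurable_nAcc (h : S.IsSpecSampling P) (i : Fin K) (l : ℕ) :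
    Measurable (S.nAcc N i l) :=
  measurable_to_countable' fun n => S.past.le _ _ (h.measurableSet_nAcc_eq i l n)

theorem integrable_comp_nAcc [IsProbabilityMeasure P] (h : S.IsSpecSampling P) (i : Fin K) (l : ℕ)
    (F : ℕ → ℝ) : Integrable (fun ω => F (S.nAcc N i l ω)) P := by
  refine Integrable.of_bound (C := ∑ n ∈ Finset.range (N + 1), |F n|)
    ((measurable_from_top (f := F)).comp (h.measurable_nAcc i l)).aestronglyMeasurable
    (ae_of_all _ fun ω => ?_)
  exact Finset.single_le_sum (f := fun n => |F n|) (fun _ _ => abs_nonneg _)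
    (Finset.mem_range.mpr (Nat.lt_succ_of_le (nAcc_le i l ω)))

end IsSpecSampling

theorem IsStationary.measureReal_inter_le_nAcc [IsProbabilityMeasure P]
    (hst : S.IsStationary P ν) (h : S.IsSpecSampling P) (i : Fin K) (l : ℕ)
    {E : Set Ω} (hE : MeasurableSet[S.past l] E) {s : ℕ} (hs : s ≤ N) :
    P.real (E ∩ {ω | s ≤ S.nAcc N i l ω}) = P.real E * (∫ x, x ∂(ν i)) ^ s := by
  induction s with
  | zero => simp
  | succ k ih =>
    have h1 : E ∩ {ω | k + 1 ≤ S.nAcc N i l ω}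
        = (E ∩ {ω | k ≤ S.nAcc N i l ω}) ∩ {ω | S.Accepted i (l + k) ω} := by
      ext ω
      simp only [Set.mem_inter_iff, Set.mem_ofPred_eq, le_nAcc_iff i l ω hs,
        le_nAcc_iff i l ω (Nat.le_of_succ_le hs), Nat.forall_lt_succ_right, and_assoc]
    rw [h1, hst.measureReal_inter_accepted h i (l + k)
      ((S.past.mono (Nat.le_add_right l k) _ hE).inter (h.measurableSet_le_nAcc i l k)),
      ih (Nat.le_of_succ_le hs)]
    ring

/-- Telescoping reduces any function of `nAcc` to the tail events, whose probabilities are powers of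
`α_i`. -/
theorem sum_indicator_le_nat (F : ℕ → ℝ) {n N : ℕ} (hn : n ≤ N) :
    F n = F 0 + ∑ s ∈ Finset.range N, if s + 1 ≤ n then F (s + 1) - F s else 0 := by
  rw [← Finset.sum_filter]
  have : (Finset.range N).filter (fun s => s + 1 ≤ n) = Finset.range n := by
    ext s; simp only [Finset.mem_filter, Finset.mem_range]; omega
  rw [this, Finset.sum_range_sub]
  ring

theorem IsStationary.setIntegral_comp_nAcc [IsProbabilityMeasure P]
    (hst : S.IsStationary P ν) (h : S.IsSpecSampling P) (i : Fin K) (l : ℕ)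
    {E : Set Ω} (hE : MeasurableSet[S.past l] E) (F : ℕ → ℝ) :
    ∫ ω in E, F (S.nAcc N i l ω) ∂P = P.real E *
      (F 0 + ∑ s ∈ Finset.range N, (∫ x, x ∂(ν i)) ^ (s + 1) * (F (s + 1) - F s)) := by
  have hm : ∀ s, MeasurableSet {ω | s + 1 ≤ S.nAcc N i l ω} := fun s =>
    S.past.le _ _ (h.measurableSet_le_nAcc i l (s + 1))
  have h1 : (fun ω => F (S.nAcc N i l ω)) = fun ω => F 0 + ∑ s ∈ Finset.range N,
      Set.indicator {ω | s + 1 ≤ S.nAcc N i l ω} (fun _ => F (s + 1) - F s) ω := by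
    ext ω
    rw [sum_indicator_le_nat F (nAcc_le i l ω)]
    simp [Set.indicator_apply]
  have hi : ∀ s, Integrable (Set.indicator {ω | s + 1 ≤ S.nAcc N i l ω}
      (fun _ => F (s + 1) - F s)) (P.restrict E) := fun s => (integrable_const _).indicator (hm s)
  rw [h1, integral_add (integrable_const _) (integrable_finsetSum _ fun s _ => hi s),
    integral_finsetSum _ fun s _ => hi s, mul_add, Finset.mul_sum]
  congr 1
  · simp
  · refine Finset.sum_congr rfl fun s hs => ?_
    rw [integral_indicator (hm s), setIntegral_const, smul_eq_mul, measureReal_restrict_apply (hm s),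
      Set.inter_comm, hst.measureReal_inter_le_nAcc h i l hE (Finset.mem_range.mp hs)]
    exact mul_assoc _ _ _

theorem IsStationary.integral_comp_nAcc [IsProbabilityMeasure P]
    (hst : S.IsStationary P ν) (h : S.IsSpecSampling P) (i : Fin K) (l : ℕ) (F : ℕ → ℝ) :
    ∫ ω, F (S.nAcc N i l ω) ∂P =
      F 0 + ∑ s ∈ Finset.range N, (∫ x, x ∂(ν i)) ^ (s + 1) * (F (s + 1) - F s) := by
  simpa using hst.setIntegral_comp_nAcc h i l (E := Set.univ) MeasurableSet.univ F

/-- A round is independent of the past, and its law does not depend on where it starts. -/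
theorem IsStationary.setIntegral_comp_nAcc_eq [IsProbabilityMeasure P]
    (hst : S.IsStationary P ν) (h : S.IsSpecSampling P) (i : Fin K) (l : ℕ)
    {E : Set Ω} (hE : MeasurableSet[S.past l] E) (F : ℕ → ℝ) :
    ∫ ω in E, F (S.nAcc N i l ω) ∂P = P.real E * ∫ ω, F (S.nAcc N i 0 ω) ∂P := by
  rw [hst.setIntegral_comp_nAcc h i l hE, hst.integral_comp_nAcc h]

end SpecSampling

/-! ### Histories -/

theorem tokens_append {K : ℕ} (H : History K) (x : Fin K × ℕ) :
    tokens (H ++ [x]) = tokens H + (x.2 + 1) := by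
  simp [tokens]

theorem pulls_append {K : ℕ} (i : Fin K) (H : History K) (x : Fin K × ℕ) :
    pulls i (H ++ [x]) = pulls i H + if x.1 = i then 1 else 0 := by
  by_cases hx : x.1 = i <;> simp [pulls, hx]

theorem pulls_le_length {K : ℕ} (i : Fin K) (H : History K) : pulls i H ≤ H.length :=
  List.length_filter_le _ _

/-- Sum of the BE rewards of drafter `i`. -/
noncomputable def rewardSum {K : ℕ} (N : ℕ) (i : Fin K) (H : History K) : ℝ :=
  ((H.filter fun x => x.1 = i).map fun x => (x.2 : ℝ) / N).sum

theorem rewardSum_append {K : ℕ} (N : ℕ) (i : Fin K) (H : History K) (x : Fin K × ℕ) :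
    rewardSum N i (H ++ [x]) = rewardSum N i H + if x.1 = i then (x.2 : ℝ) / N else 0 := by
  by_cases hx : x.1 = i <;> simp [rewardSum, hx]

theorem empMeanBE_eq {K : ℕ} (N : ℕ) (i : Fin K) (H : History K) :
    empMeanBE N i H = rewardSum N i H / pulls i H := rfl

namespace SpecSampling

variable {K : ℕ} {V Ω : Type*} [MeasurableSpace Ω]
  {P : Measure Ω} {S : SpecSampling K V Ω} {ν : Fin K → Measure ℝ} {N : ℕ}

theorem history_succ (S : SpecSampling K V Ω) (N : ℕ) (π : Policy K) (ω : Ω) (t : ℕ) :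
    S.history N π ω (t + 1) = S.history N π ω t ++
      [(π (S.history N π ω t),
        S.nAcc N (π (S.history N π ω t)) (tokens (S.history N π ω t)) ω)] := rfl

theorem length_history (π : Policy K) (ω : Ω) (t : ℕ) : (S.history N π ω t).length = t := by
  induction t with
  | zero => rfl
  | succ t ih => rw [history_succ, List.length_append, ih]; rfl

theorem finite_range_history (S : SpecSampling K V Ω) (N : ℕ) (π : Policy K) (t : ℕ) :
    (Set.range fun ω => S.history N π ω t).Finite := by
  induction t with
  | zero => exact (Set.finite_singleton []).subset (by rintro _ ⟨ω, rfl⟩; rfl)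
  | succ t ih =>
    refine (Set.Finite.image2 (fun H n => H ++ [(π H, n)]) ih (Set.finite_Iic N)).subset ?_
    rintro _ ⟨ω, rfl⟩
    exact ⟨_, ⟨ω, rfl⟩, _, nAcc_le _ _ ω, rfl⟩

/-- The possible histories of `t` rounds. -/
noncomputable def histories (S : SpecSampling K V Ω) (N : ℕ) (π : Policy K) (t : ℕ) :
    Finset (History K) :=
  (S.finite_range_history N π t).toFinset

/-- Rounds start at random positions. Splitting over the finitely many histories makes the starting
position constant on each piece, so no stopping times are needed. -/
theorem history_eq_sum_indicator (π : Policy K) (t : ℕ) (F : History K → Ω → ℝ) (ω : Ω) :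
    F (S.history N π ω t) ω = ∑ H ∈ S.histories N π t,
      Set.indicator {ω | S.history N π ω t = H} (F H) ω := by
  rw [Finset.sum_eq_single (S.history N π ω t)]
  · simp
  · intro H _ hH
    exact Set.indicator_of_notMem (by simpa using hH.symm) _
  · intro hH
    simp [histories] at hH

theorem rBE_mem (i : Fin K) (l : ℕ) (ω : Ω) : S.rBE N i l ω ∈ Set.Icc (0 : ℝ) 1 := by
  refine ⟨by unfold rBE; positivity, ?_⟩
  exact div_le_one_of_le₀ (by exact_mod_cast nAcc_le i l ω) (Nat.cast_nonneg N)

variable [Fintype V]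

/-- A history determines how many positions it has consumed, so the event is decided before position
`tokens H`, where the next round starts. -/
theorem IsSpecSampling.measurableSet_history_eq (h : S.IsSpecSampling P) (π : Policy K) (t : ℕ)
    (H : History K) : MeasurableSet[S.past (tokens H)] {ω | S.history N π ω t = H} := by
  induction t generalizing H with
  | zero =>
    by_cases hH : H = []
    · subst hH
      simp [history]
    · have : {ω | S.history N π ω 0 = H} = ∅ := by
        ext ω
        simpa [history] using Ne.symm hH
      rw [this]
      exact @MeasurableSet.empty _ (S.past _)
  | succ t ih =>
    have hemp : ∀ s : Set Ω, s = ∅ → MeasurableSet[S.past (tokens H)] s := by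
      rintro _ rfl
      exact @MeasurableSet.empty _ (S.past _)
    rcases List.eq_nil_or_concat' H with rfl | ⟨H', ⟨i, n⟩, rfl⟩
    · refine hemp _ ?_
      ext ω
      simp [history_succ]
    · by_cases hi : π H' = i
      · have : {ω | S.history N π ω (t + 1) = H' ++ [(i, n)]}
            = {ω | S.history N π ω t = H'} ∩ {ω | S.nAcc N i (tokens H') ω = n} := by
          ext ω
          simp only [history_succ, Set.mem_ofPred_eq, Set.mem_inter_iff]
          constructor
          · intro he
            obtain ⟨h1, h2⟩ := List.append_inj' he rfl
            rw [h1] at h2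
            simp only [List.cons.injEq, Prod.mk.injEq, and_true] at h2
            rw [h2.1] at h2
            exact ⟨h1, h2.2⟩
          · rintro ⟨h1, h2⟩
            rw [h1, hi, h2]
        rw [this, tokens_append]
        exact (S.past.mono (Nat.le_add_right _ _) _ (ih H')).inter
          (h.measurableSet_nAcc_eq i (tokens H') n)
      · refine hemp _ ?_
        ext ω
        simp only [history_succ, Set.mem_ofPred_eq, Set.mem_empty_iff_false, iff_false]
        intro he
        obtain ⟨h1, h2⟩ := List.append_inj' he rfl
        rw [h1] at h2
        simp only [List.cons.injEq, Prod.mk.injEq, and_true] at h2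
        exact hi h2.1

theorem IsSpecSampling.measurableSet_history (h : S.IsSpecSampling P) (π : Policy K) (t : ℕ)
    (A : Set (History K)) : MeasurableSet {ω | S.history N π ω t ∈ A} := by
  classical
  have : {ω | S.history N π ω t ∈ A}
      = ⋃ H ∈ (S.histories N π t).filter (· ∈ A), {ω | S.history N π ω t = H} := by
    ext ω
    simp [histories]
  rw [this]
  exact Finset.measurableSet_biUnion _ fun H _ =>
    S.past.le _ _ (h.measurableSet_history_eq π t H)

variable [IsProbabilityMeasure P]

theorem IsSpecSampling.integrable_history (h : S.IsSpecSampling P) (π : Policy K) (t : ℕ)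
    (F : History K → ℝ) : Integrable (fun ω => F (S.history N π ω t)) P := by
  rw [funext fun ω => history_eq_sum_indicator π t (fun H _ => F H) ω]
  exact integrable_finsetSum _ fun H _ =>
    (integrable_const _).indicator (S.past.le _ _ (h.measurableSet_history_eq π t H))

/-- Conditional expectation of a function of the next history given the present one. -/
noncomputable def stepMean (S : SpecSampling K V Ω) (P : Measure Ω) (N : ℕ) (π : Policy K)
    (F : History K → ℝ) (H : History K) : ℝ :=
  ∫ ω, F (H ++ [(π H, S.nAcc N (π H) 0 ω)]) ∂P

/-- Markov property: where the history is `H`, the next round starts at the fixed position `tokens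
H`, is independent of that event, and may be replaced by a round from position `0`. -/
theorem IsStationary.integral_history_succ (hst : S.IsStationary P ν) (h : S.IsSpecSampling P)
    (π : Policy K) (t : ℕ) (F : History K → ℝ) :
    ∫ ω, F (S.history N π ω (t + 1)) ∂P
      = ∫ ω, S.stepMean P N π F (S.history N π ω t) ∂P := by
  have hm : ∀ H, MeasurableSet {ω | S.history N π ω t = H} := fun H =>
    S.past.le _ _ (h.measurableSet_history_eq π t H)
  simp_rw [history_succ]
  rw [funext fun ω => history_eq_sum_indicator π t
      (fun H ω => F (H ++ [(π H, S.nAcc N (π H) (tokens H) ω)])) ω,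
    funext fun ω => history_eq_sum_indicator π t (fun H _ => S.stepMean P N π F H) ω,
    integral_finsetSum, integral_finsetSum]
  · refine Finset.sum_congr rfl fun H _ => ?_
    rw [integral_indicator (hm H), integral_indicator (hm H), setIntegral_const, smul_eq_mul]
    exact hst.setIntegral_comp_nAcc_eq h (π H) (tokens H) (h.measurableSet_history_eq π t H)
      (fun n => F (H ++ [(π H, n)]))
  · exact fun H _ => (integrable_const _).indicator (hm H)
  · exact fun H _ => (h.integrable_comp_nAcc (π H) (tokens H)
      (fun n => F (H ++ [(π H, n)]))).indicator (hm H)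

/-! ### Concentration of the empirical means -/

/-- Hoeffding's lemma: an interval of length `1` gives variance proxy `1/4`. -/
theorem IsSpecSampling.integral_exp_rBE_le (h : S.IsSpecSampling P) (i : Fin K) (x : ℝ) :
    ∫ ω, Real.exp (x * (S.rBE N i 0 ω - S.meanBE N P i)) ∂P ≤ Real.exp (x ^ 2 / 8) := by
  have hm : Measurable (S.rBE N i 0) :=
    (measurable_from_top.comp (h.measurable_nAcc i 0)).div_const _
  have h1 := (hasSubgaussianMGF_of_mem_Icc hm.aemeasurable
    (ae_of_all P fun ω => rBE_mem (S := S) (N := N) i 0 ω)).mgf_le x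
  refine h1.trans (Real.exp_le_exp.mpr (le_of_eq ?_))
  simp
  ring

/-- Exponential supermartingale for the rewards of drafter `i`. -/
noncomputable def expDev (S : SpecSampling K V Ω) (P : Measure Ω) (N : ℕ) (i : Fin K) (x : ℝ)
    (H : History K) : ℝ :=
  Real.exp (x * (rewardSum N i H - S.meanBE N P i * pulls i H) - x ^ 2 / 8 * pulls i H)

/-- A use of `i` multiplies the process by a factor of mean at most `1`; any other choice leaves it
unchanged. -/
theorem IsSpecSampling.stepMean_expDev_le (h : S.IsSpecSampling P) (π : Policy K) (i : Fin K)
    (x : ℝ) (H : History K) :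
    S.stepMean P N π (S.expDev P N i x) H ≤ S.expDev P N i x H := by
  unfold stepMean
  by_cases hi : π H = i
  · have h1 : ∀ ω, S.expDev P N i x (H ++ [(π H, S.nAcc N (π H) 0 ω)])
        = (S.expDev P N i x H * Real.exp (-(x ^ 2 / 8)))
          * Real.exp (x * (S.rBE N i 0 ω - S.meanBE N P i)) := by
      intro ω
      simp only [expDev, rewardSum_append, pulls_append, hi, if_true]
      rw [← Real.exp_add, ← Real.exp_add, rBE]
      congr 1
      push_cast
      ring
    simp_rw [h1]
    rw [integral_const_mul]
    calc _ ≤ (S.expDev P N i x H * Real.exp (-(x ^ 2 / 8))) * Real.exp (x ^ 2 / 8) :=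
          mul_le_mul_of_nonneg_left (h.integral_exp_rBE_le i x)
            (mul_nonneg (Real.exp_pos _).le (Real.exp_pos _).le)
      _ = _ := by rw [mul_assoc, ← Real.exp_add]; simp
  · simp [expDev, rewardSum_append, pulls_append, hi]

theorem IsStationary.integral_expDev_le_one (hst : S.IsStationary P ν) (h : S.IsSpecSampling P)
    (π : Policy K) (i : Fin K) (x : ℝ) (t : ℕ) :
    ∫ ω, S.expDev P N i x (S.history N π ω t) ∂P ≤ 1 := by
  induction t with
  | zero => simp [history, expDev, rewardSum, pulls]
  | succ t ih =>
    rw [hst.integral_history_succ h]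
    exact (integral_mono (h.integrable_history π t _) (h.integrable_history π t _)
      fun ω => h.stepMean_expDev_le π i x _).trans ih

end SpecSampling

/-- After `s` uses of drafter `i`, its mean reward deviates from `μ` by at least `ε`, in the
direction of the sign `σ`. -/
def deviation {K : ℕ} (N : ℕ) (i : Fin K) (μ σ : ℝ) (s : ℕ) (ε : ℝ) : Set (History K) :=
  {H | pulls i H = s ∧ s * ε ≤ σ * (rewardSum N i H - μ * s)}

/-- The confidence bound of drafter `i` fails after `t` rounds. -/
def confidenceFailure {K : ℕ} (N : ℕ) (β : ℝ) (i : Fin K) (μ σ : ℝ) (t : ℕ) :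
    Set (History K) :=
  ⋃ s ∈ Finset.Icc 1 t, deviation N i μ σ s (β * Real.sqrt (2 * Real.log t / s))

namespace SpecSampling

variable {K : ℕ} {V Ω : Type*} [Fintype V] [MeasurableSpace Ω]
  {P : Measure Ω} {S : SpecSampling K V Ω} {ν : Fin K → Measure ℝ} {N : ℕ}
  [IsProbabilityMeasure P]

theorem IsStationary.measureReal_deviation_le (hst : S.IsStationary P ν) (h : S.IsSpecSampling P)
    (π : Policy K) (i : Fin K) (t s : ℕ) {σ ε : ℝ} (hσ : σ ^ 2 = 1) (hε : 0 ≤ ε) :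
    P.real {ω | S.history N π ω t ∈ deviation N i (S.meanBE N P i) σ s ε}
      ≤ Real.exp (-(2 * s * ε ^ 2)) := by
  set A := {ω | S.history N π ω t ∈ deviation N i (S.meanBE N P i) σ s ε} with hA
  have hAm : MeasurableSet A := h.measurableSet_history π t _
  have h1 : P.real A = ∫ ω, A.indicator 1 ω ∂P := (integral_indicator_one hAm).symm
  -- Chernoff bound: `x = 4 ε σ` maximizes the exponent `x σ s ε - x ^ 2 s / 8`, with value `2 s ε ^
  -- 2`. The event fixes `pulls i = s`, so the random sample size causes no trouble.
  have h2 : ∀ ω, A.indicator (1 : Ω → ℝ) ω ≤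
      Real.exp (-(2 * s * ε ^ 2)) * S.expDev P N i (4 * ε * σ) (S.history N π ω t) := by
    intro ω
    by_cases hω : ω ∈ A
    · obtain ⟨h3, h4⟩ : _ ∧ _ := hω
      rw [Set.indicator_of_mem (show ω ∈ A from ⟨h3, h4⟩), expDev, ← Real.exp_add, h3,
        Pi.one_apply]
      refine Real.one_le_exp ?_
      have h5 := mul_le_mul_of_nonneg_left h4 hε
      have h6 : (4 * ε * σ) ^ 2 = 16 * ε ^ 2 := by rw [mul_pow, hσ]; ring
      rw [h6]
      nlinarith
    · rw [Set.indicator_of_notMem hω]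
      exact mul_nonneg (Real.exp_pos _).le (Real.exp_pos _).le
  rw [h1]
  calc _ ≤ ∫ ω, Real.exp (-(2 * s * ε ^ 2)) * S.expDev P N i (4 * ε * σ) (S.history N π ω t) ∂P :=
        integral_mono ((integrable_const _).indicator hAm)
          ((h.integrable_history π t _).const_mul _) h2
    _ ≤ _ := by
      rw [integral_const_mul]
      exact mul_le_of_le_one_right (Real.exp_pos _).le (hst.integral_expDev_le_one h π i _ t)

theorem IsStationary.measureReal_confidenceFailure_le (hst : S.IsStationary P ν)
    (h : S.IsSpecSampling P) (π : Policy K) (i : Fin K) {t : ℕ} (ht : 1 ≤ t) {σ β : ℝ}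
    (hσ : σ ^ 2 = 1) (hβ : 1 ≤ β) :
    P.real {ω | S.history N π ω t ∈ confidenceFailure N β i (S.meanBE N P i) σ t}
      ≤ ((t : ℝ) ^ 2)⁻¹ := by
  have ht0 : (0 : ℝ) < t := by exact_mod_cast ht
  have ht1 : (1 : ℝ) ≤ t := by exact_mod_cast ht
  have hlog : 0 ≤ Real.log t := Real.log_nonneg ht1
  have h1 : {ω | S.history N π ω t ∈ confidenceFailure N β i (S.meanBE N P i) σ t}
      = ⋃ s ∈ Finset.Icc 1 t, {ω | S.history N π ω t ∈ deviation N i (S.meanBE N P i) σ s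
          (β * Real.sqrt (2 * Real.log t / s))} := by
    ext ω
    simp [confidenceFailure]
  rw [h1]
  refine (measureReal_biUnion_finset_le _ _).trans ?_
  -- Each sample size contributes `exp (-4 β ^ 2 ln t) ≤ t ^ (-3)`, as `β ≥ 1`, and there are `t` of
  -- them.
  calc _ ≤ ∑ s ∈ Finset.Icc 1 t, ((t : ℝ) ^ 3)⁻¹ := by
        refine Finset.sum_le_sum fun s hs => ?_
        have hs0 : (0 : ℝ) < s := by exact_mod_cast (Finset.mem_Icc.mp hs).1
        refine (hst.measureReal_deviation_le h π i t s hσ (by positivity)).trans ?_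
        rw [mul_pow, Real.sq_sqrt (by positivity), ← Real.exp_log (inv_pos.mpr (pow_pos ht0 3)),
          Real.log_inv, Real.log_pow]
        refine Real.exp_le_exp.mpr (neg_le_neg ?_)
        have h2 : 2 * (s : ℝ) * (β ^ 2 * (2 * Real.log t / s)) = 4 * β ^ 2 * Real.log t := by
          field_simp
          ring
        rw [h2]
        push_cast
        have hβ2 : 1 ≤ β ^ 2 := one_le_pow₀ hβ
        exact mul_le_mul_of_nonneg_right (by linarith) hlog
    _ = _ := by
      rw [Finset.sum_const, Nat.card_Icc, nsmul_eq_mul, Nat.add_sub_cancel]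
      field_simp

end SpecSampling

/-! ### Analysis of the UCB rule -/

/-- If both bounds held, then `μ⋆ < index of istar ≤ index of i < μ_i + 2 b_i` with `b_i` the bonus
of the chosen `i`. So the gap is below `2 b_i`, which upon squaring contradicts the number of uses.
-/
theorem IsMetaSDUCB.mem_confidenceFailure {K N : ℕ} {β : ℝ} {π : Policy K}
    (hπ : IsMetaSDUCB N β π) (hβ : 0 < β) {H : History K} (hH : K ≤ H.length)
    (hp : ∀ j, 1 ≤ pulls j H) {istar : Fin K} {μ : Fin K → ℝ} (hμ : μ (π H) < μ istar)
    {B : ℕ} (hB : H.length ≤ B)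
    (hpulls : 8 * β ^ 2 / (μ istar - μ (π H)) ^ 2 * Real.log B ≤ pulls (π H) H) :
    H ∈ confidenceFailure N β (π H) (μ (π H)) 1 H.length ∨
      H ∈ confidenceFailure N β istar (μ istar) (-1) H.length := by
  by_contra hcon
  push Not at hcon
  obtain ⟨h1, h2⟩ := hcon
  set i := π H with hi
  have hlen : 1 ≤ H.length := (hp i).trans (pulls_le_length i H)
  have hlog : 0 ≤ Real.log H.length := Real.log_nonneg (by exact_mod_cast hlen)
  have hlogB : Real.log H.length ≤ Real.log B :=
    Real.log_le_log (by exact_mod_cast hlen) (by exact_mod_cast hB)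
  have hni : (0 : ℝ) < pulls i H := by exact_mod_cast hp i
  have hns : (0 : ℝ) < pulls istar H := by exact_mod_cast hp istar
  have key : ∀ j σ, H ∉ confidenceFailure N β j (μ j) σ H.length →
      σ * (rewardSum N j H - μ j * pulls j H)
        < pulls j H * (β * Real.sqrt (2 * Real.log H.length / pulls j H)) := by
    intro j σ hj
    by_contra hle
    refine hj (Set.mem_biUnion (x := pulls j H) ?_ ⟨rfl, not_lt.mp hle⟩)
    exact Finset.mem_Icc.mpr ⟨hp j, pulls_le_length j H⟩
  have k1 := key i 1 h1
  have k2 := key istar (-1) h2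
  have hidx := hπ.2 H hH istar
  rw [← hi] at hidx
  unfold ucbIndex at hidx
  rw [empMeanBE_eq, empMeanBE_eq] at hidx
  set bi := β * Real.sqrt (2 * Real.log H.length / pulls i H) with hbi
  set bs := β * Real.sqrt (2 * Real.log H.length / pulls istar H) with hbs
  have e1 : rewardSum N i H / pulls i H < μ i + bi := by
    rw [div_lt_iff₀ hni]; nlinarith
  have e2 : μ istar - bs < rewardSum N istar H / pulls istar H := by
    rw [lt_div_iff₀ hns]; nlinarith
  have hΔ : 0 < μ istar - μ i := sub_pos.mpr hμ
  have e3 : μ istar - μ i < 2 * bi := by linarith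
  have e4 : (μ istar - μ i) ^ 2 < (2 * bi) ^ 2 := pow_lt_pow_left₀ e3 hΔ.le two_ne_zero
  rw [hbi, mul_pow, mul_pow, Real.sq_sqrt (by positivity)] at e4
  have e5 : 2 ^ 2 * (β ^ 2 * (2 * Real.log H.length / pulls i H)) * pulls i H
      = 8 * β ^ 2 * Real.log H.length := by
    field_simp
    ring
  have e6 := mul_lt_mul_of_pos_right e4 hni
  rw [e5] at e6
  rw [div_mul_eq_mul_div, div_le_iff₀ (by positivity)] at hpulls
  have e7 : 8 * β ^ 2 * Real.log H.length ≤ 8 * β ^ 2 * Real.log B :=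
    mul_le_mul_of_nonneg_left hlogB (by positivity)
  linarith

namespace SpecSampling

variable {K : ℕ} {V Ω : Type*} [MeasurableSpace Ω]
  {P : Measure Ω} {S : SpecSampling K V Ω} {ν : Fin K → Measure ℝ} {N : ℕ}

theorem pulls_history_succ (π : Policy K) (ω : Ω) (i : Fin K) (t : ℕ) :
    pulls i (S.history N π ω (t + 1))
      = pulls i (S.history N π ω t) + if π (S.history N π ω t) = i then 1 else 0 := by
  rw [history_succ, pulls_append]

theorem one_le_pulls_history {β : ℝ} {π : Policy K} (hπ : IsMetaSDUCB N β π) (ω : Ω) (j : Fin K)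
    {t : ℕ} (hj : (j : ℕ) < t) : 1 ≤ pulls j (S.history N π ω t) := by
  induction t with
  | zero => omega
  | succ t ih =>
    rw [pulls_history_succ]
    rcases Nat.lt_succ_iff_lt_or_eq.mp hj with hlt | heq
    · exact (ih hlt).trans (Nat.le_add_right _ _)
    · have hlen := length_history (S := S) (N := N) π ω t
      have h1 := hπ.1 (S.history N π ω t) (by rw [hlen, ← heq]; exact j.2)
      have h2 : π (S.history N π ω t) = j := by
        rw [h1]; exact Fin.ext (by simp only [hlen, heq])
      rw [if_pos h2]
      omega

/-- A drafter is used at most `u + 1` times while it has been used less than `u` times. -/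
theorem sum_use_of_pulls_lt_le (π : Policy K) (ω : Ω) (i : Fin K) {u : ℝ} (hu : 0 ≤ u) (T : ℕ) :
    ∑ t ∈ Finset.range T, (if π (S.history N π ω t) = i ∧ (pulls i (S.history N π ω t) : ℝ) < u
      then (1 : ℝ) else 0) ≤ min (pulls i (S.history N π ω T) : ℝ) (u + 1) := by
  induction T with
  | zero => simp only [Finset.range_zero, Finset.sum_empty]; exact le_min (Nat.cast_nonneg _) (by linarith)
  | succ T ih =>
    rw [Finset.sum_range_succ, pulls_history_succ]
    obtain ⟨h1, h2⟩ := le_min_iff.mp ih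
    by_cases hi : π (S.history N π ω T) = i
    · by_cases hp : (pulls i (S.history N π ω T) : ℝ) < u
      · rw [if_pos ⟨hi, hp⟩, if_pos hi]
        push_cast
        exact le_min (by linarith) (by linarith)
      · rw [if_neg (fun h' => hp h'.2), if_pos hi]
        push_cast
        exact le_min (by linarith) (by linarith)
    · rw [if_neg (fun h' => hi h'.1), if_neg hi]
      push_cast
      exact le_min (by linarith) (by linarith)

open Classical in
theorem sum_use_le {β : ℝ} {π : Policy K} (hπ : IsMetaSDUCB N β π) (hβ : 0 < β) (ω : Ω)
    {i istar : Fin K} {μ : Fin K → ℝ} (hμ : μ i < μ istar) {B : ℕ} (hB : 1 ≤ B) :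
    ∑ t ∈ Finset.range B, (if π (S.history N π ω t) = i then (1 : ℝ) else 0)
      ≤ (8 * β ^ 2 / (μ istar - μ i) ^ 2 * Real.log B + 1) + K
        + ∑ t ∈ Finset.Ico K B,
          (Set.indicator {ω | S.history N π ω t ∈ confidenceFailure N β i (μ i) 1 t} 1 ω
          + Set.indicator {ω | S.history N π ω t ∈ confidenceFailure N β istar (μ istar) (-1) t}
            (1 : Ω → ℝ) ω) := by
  set u := 8 * β ^ 2 / (μ istar - μ i) ^ 2 * Real.log B with hu
  have hu0 : 0 ≤ u := mul_nonneg (by positivity) (Real.log_nonneg (by exact_mod_cast hB))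
  set b : ℕ → ℝ := fun t =>
    Set.indicator {ω | S.history N π ω t ∈ confidenceFailure N β i (μ i) 1 t} 1 ω
      + Set.indicator {ω | S.history N π ω t ∈ confidenceFailure N β istar (μ istar) (-1) t}
        (1 : Ω → ℝ) ω with hb
  have hb0 : ∀ t, 0 ≤ b t := fun t => add_nonneg
    (Set.indicator_nonneg (fun _ _ => zero_le_one) _)
    (Set.indicator_nonneg (fun _ _ => zero_le_one) _)
  -- Each use of `i` is charged to one of three causes: few uses so far, an initial round, or a
  -- failed confidence bound.
  have h1 : ∀ t ∈ Finset.range B, (if π (S.history N π ω t) = i then (1 : ℝ) else 0)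
      ≤ (if π (S.history N π ω t) = i ∧ (pulls i (S.history N π ω t) : ℝ) < u then (1 : ℝ) else 0)
        + (if t < K then 1 else 0) + (if K ≤ t then b t else 0) := by
    intro t ht
    rw [Finset.mem_range] at ht
    by_cases hi : π (S.history N π ω t) = i
    · by_cases hp : (pulls i (S.history N π ω t) : ℝ) < u
      · rw [if_pos hi, if_pos ⟨hi, hp⟩]
        have := hb0 t
        split_ifs <;> linarith
      · rw [if_pos hi, if_neg fun h' => hp h'.2]
        by_cases hK : t < K
        · rw [if_pos hK, if_neg (by omega)]; norm_num
        · have hK' : K ≤ t := not_lt.mp hK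
          rw [if_neg hK, if_pos hK']
          have hlen := length_history (S := S) (N := N) π ω t
          have := hπ.mem_confidenceFailure hβ (H := S.history N π ω t) (by rw [hlen]; exact hK')
            (fun j => one_le_pulls_history hπ ω j (j.2.trans_le hK')) (istar := istar) (μ := μ)
            (by rw [hi]; exact hμ) (B := B) (by rw [hlen]; exact ht.le)
            (by rw [hi]; exact not_lt.mp hp)
          rw [hi, hlen] at this
          rcases this with hf | hf
          · have e1 : Set.indicator {ω | S.history N π ω t ∈ confidenceFailure N β i (μ i) 1 t}
                (1 : Ω → ℝ) ω = 1 := by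
              rw [Set.indicator_of_mem (by exact hf)]; rfl
            have e2 := Set.indicator_nonneg (s := {ω | S.history N π ω t ∈
              confidenceFailure N β istar (μ istar) (-1) t}) (f := (1 : Ω → ℝ))
              (fun _ _ => zero_le_one) ω
            simp only [hb]
            linarith
          · have e1 : Set.indicator {ω | S.history N π ω t ∈
                confidenceFailure N β istar (μ istar) (-1) t} (1 : Ω → ℝ) ω = 1 := by
              rw [Set.indicator_of_mem (by exact hf)]; rfl
            have e2 := Set.indicator_nonneg (s := {ω | S.history N π ω t ∈
              confidenceFailure N β i (μ i) 1 t}) (f := (1 : Ω → ℝ))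
              (fun _ _ => zero_le_one) ω
            simp only [hb]
            linarith
    · rw [if_neg hi, if_neg fun h' => hi h'.1]
      have := hb0 t
      split_ifs <;> linarith
  refine (Finset.sum_le_sum h1).trans ?_
  rw [Finset.sum_add_distrib, Finset.sum_add_distrib]
  refine add_le_add (add_le_add ?_ ?_) ?_
  · exact (sum_use_of_pulls_lt_le π ω i hu0 B).trans (min_le_right _ _)
  · rw [← Finset.sum_filter, Finset.sum_const, nsmul_eq_mul, mul_one]
    have : ((Finset.range B).filter (· < K)) ⊆ Finset.range K := by
      intro t ht
      rw [Finset.mem_filter] at ht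
      exact Finset.mem_range.mpr ht.2
    have := Finset.card_le_card this
    rw [Finset.card_range] at this
    exact_mod_cast this
  · rw [← Finset.sum_filter]
    refine le_of_eq (Finset.sum_congr ?_ fun _ _ => rfl)
    ext t
    simp only [Finset.mem_filter, Finset.mem_range, Finset.mem_Ico]
    omega

/-- As `K ≥ 2`, the sum starts at `2` or later and is dominated by the telescoping `1 / (t - 1) - 1
/ t`. -/
theorem sum_Ico_inv_sq_le {K B : ℕ} (hK : 2 ≤ K) :
    ∑ t ∈ Finset.Ico K B, ((t : ℝ) ^ 2)⁻¹ ≤ 1 := by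
  rcases Nat.eq_zero_or_pos B with rfl | hB
  · simp
  calc _ ≤ ∑ t ∈ Finset.Ioc 1 B, ((t : ℝ) ^ 2)⁻¹ := by
        refine Finset.sum_le_sum_of_subset_of_nonneg (fun t ht => ?_) fun _ _ _ => by positivity
        simp only [Finset.mem_Ico, Finset.mem_Ioc] at ht ⊢
        omega
    _ ≤ ((1 : ℕ) : ℝ)⁻¹ - (B : ℝ)⁻¹ := sum_Ioc_inv_sq_le_sub one_ne_zero hB
    _ ≤ 1 := by
      have : (0 : ℝ) ≤ (B : ℝ)⁻¹ := by positivity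
      simp only [Nat.cast_one, inv_one]
      linarith

variable [Fintype V] [IsProbabilityMeasure P]

/-- Expected number of uses of a suboptimal drafter by MetaSD-UCB. -/
theorem IsStationary.integral_sum_use_le (hst : S.IsStationary P ν) (h : S.IsSpecSampling P)
    (hK : 2 ≤ K) {β : ℝ} (hβ : 1 ≤ β) {π : Policy K} (hπ : IsMetaSDUCB N β π)
    {i istar : Fin K} (hi : S.meanBE N P i < S.meanBE N P istar) {B : ℕ} (hB : 1 ≤ B) :
    ∑ t ∈ Finset.range B, ∫ ω, (if π (S.history N π ω t) = i then (1 : ℝ) else 0) ∂P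
      ≤ 8 * β ^ 2 / (S.meanBE N P istar - S.meanBE N P i) ^ 2 * Real.log B + (K + 3) := by
  classical
  have hm : ∀ j σ t, MeasurableSet
      {ω | S.history N π ω t ∈ confidenceFailure N β j (S.meanBE N P j) σ t} :=
    fun j σ t => h.measurableSet_history π t _
  have hint : ∀ j σ t, Integrable (Set.indicator
      {ω | S.history N π ω t ∈ confidenceFailure N β j (S.meanBE N P j) σ t} (1 : Ω → ℝ)) P :=
    fun j σ t => (integrable_const (1 : ℝ)).indicator (hm j σ t)
  set b : ℕ → Ω → ℝ := fun t ω => Set.indicator {ω | S.history N π ω t ∈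
        confidenceFailure N β i (S.meanBE N P i) 1 t} 1 ω
      + Set.indicator {ω | S.history N π ω t ∈
        confidenceFailure N β istar (S.meanBE N P istar) (-1) t} (1 : Ω → ℝ) ω with hb
  have hbi : ∀ t, Integrable (b t) P := fun t => (hint i 1 t).add (hint istar (-1) t)
  have hs : Integrable (fun ω => ∑ t ∈ Finset.Ico K B, b t ω) P :=
    integrable_finsetSum _ fun t _ => hbi t
  rw [← integral_finsetSum _ fun t _ => h.integrable_history π t (fun H => if π H = i then 1 else 0)]
  refine (integral_mono (integrable_finsetSum _ fun t _ =>
    h.integrable_history π t (fun H => if π H = i then 1 else 0))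
    ((integrable_const _).add hs) fun ω => sum_use_le hπ (by linarith) ω hi hB).trans ?_
  simp only [Pi.add_apply]
  rw [integral_add (integrable_const _) hs, integral_const, probReal_univ, one_smul,
    integral_finsetSum _ fun t _ => hbi t]
  have h1 : ∀ t ∈ Finset.Ico K B, ∫ ω, b t ω ∂P ≤ ((t : ℝ) ^ 2)⁻¹ + ((t : ℝ) ^ 2)⁻¹ := by
    intro t ht
    have ht1 : 1 ≤ t := by have := (Finset.mem_Ico.mp ht).1; omega
    simp only [hb]
    rw [integral_add (hint i 1 t) (hint istar (-1) t), integral_indicator_one (hm i 1 t),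
      integral_indicator_one (hm istar (-1) t)]
    exact add_le_add (hst.measureReal_confidenceFailure_le h π i ht1 (by norm_num) hβ)
      (hst.measureReal_confidenceFailure_le h π istar ht1 (by norm_num) hβ)
  have h2 := Finset.sum_le_sum h1
  rw [Finset.sum_add_distrib] at h2
  -- `K + 3` collects one use beyond the threshold, the `K` initial rounds, and at most `1` for each
  -- of the two confidence bounds.
  have h3 := sum_Ico_inv_sq_le (B := B) hK
  linarith

end SpecSampling

/-! ### Number of rounds -/

namespace SpecSampling

variable {K : ℕ} {V Ω : Type*} [MeasurableSpace Ω]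
  {P : Measure Ω} {S : SpecSampling K V Ω} {ν : Fin K → Measure ℝ} {N : ℕ}

theorem tokens_history_succ (π : Policy K) (ω : Ω) (t : ℕ) :
    tokens (S.history N π ω (t + 1)) = tokens (S.history N π ω t)
      + (S.nAcc N (π (S.history N π ω t)) (tokens (S.history N π ω t)) ω + 1) := by
  rw [history_succ, tokens_append]

theorem monotone_tokens_history (π : Policy K) (ω : Ω) :
    Monotone fun t => tokens (S.history N π ω t) :=
  monotone_nat_of_le_succ fun t => by rw [tokens_history_succ]; omega

theorem le_tokens_history (π : Policy K) (ω : Ω) (t : ℕ) : t ≤ tokens (S.history N π ω t) := by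
  induction t with
  | zero => exact Nat.zero_le _
  | succ t ih => rw [tokens_history_succ]; omega

/-- `1` as long as less than `B` tokens have been generated. -/
def running {K : ℕ} (B : ℕ) (H : History K) : ℝ := if tokens H < B then 1 else 0

theorem running_nonneg {K : ℕ} (B : ℕ) (H : History K) : 0 ≤ running B H := by
  unfold running; split_ifs <;> norm_num

theorem rounds_zero_spec (π : Policy K) (B : ℕ) (ω : Ω) :
    B ≤ tokens (S.history N π ω (S.rounds N 0 π B ω)) :=
  (Nat.sInf_mem (s := {t | 0 ≤ t ∧ B ≤ tokens (S.history N π ω t)})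
    ⟨B, Nat.zero_le _, le_tokens_history π ω B⟩).2

/-- Horizon `B` suffices because every round yields at least one token. -/
theorem rounds_zero_eq_sum (π : Policy K) (B : ℕ) (ω : Ω) :
    (S.rounds N 0 π B ω : ℝ) = ∑ t ∈ Finset.range B, running B (S.history N π ω t) := by
  have h1 := rounds_zero_spec (S := S) (N := N) π B ω
  have h2 : S.rounds N 0 π B ω ≤ B := Nat.sInf_le ⟨Nat.zero_le _, le_tokens_history π ω B⟩
  have h3 : (Finset.range B).filter (fun t => tokens (S.history N π ω t) < B)
      = Finset.range (S.rounds N 0 π B ω) := by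
    ext t
    simp only [Finset.mem_filter, Finset.mem_range]
    constructor
    · rintro ⟨-, ht⟩
      by_contra hle
      have : tokens (S.history N π ω (S.rounds N 0 π B ω)) ≤ tokens (S.history N π ω t) :=
        monotone_tokens_history π ω (not_lt.mp hle)
      omega
    · intro ht
      refine ⟨by omega, ?_⟩
      by_contra hle
      exact Nat.notMem_of_lt_sInf ht ⟨Nat.zero_le _, not_lt.mp hle⟩
  unfold running
  rw [← Finset.sum_filter, h3]
  simp

theorem rounds_le_add (m : ℕ) (π : Policy K) (B : ℕ) (ω : Ω) :
    S.rounds N m π B ω ≤ m + S.rounds N 0 π B ω :=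
  Nat.sInf_le ⟨Nat.le_add_right _ _, (rounds_zero_spec π B ω).trans
    (monotone_tokens_history π ω (Nat.le_add_left _ _))⟩

/-- Tokens generated in round `t`, if that round is played. -/
noncomputable def gain (S : SpecSampling K V Ω) (N : ℕ) (π : Policy K) (B t : ℕ) (ω : Ω) : ℝ :=
  running B (S.history N π ω t) *
    (tokens (S.history N π ω (t + 1)) - tokens (S.history N π ω t) : ℝ)

theorem min_le_sum_gain (π : Policy K) (B : ℕ) (ω : Ω) (T : ℕ) :
    min (tokens (S.history N π ω T) : ℝ) B ≤ ∑ t ∈ Finset.range T, S.gain N π B t ω := by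
  induction T with
  | zero => simp [history, tokens]
  | succ T ih =>
    rw [Finset.sum_range_succ]
    unfold gain running at *
    split_ifs with hlt
    · have : (tokens (S.history N π ω T) : ℝ) ≤ B := by exact_mod_cast hlt.le
      rw [min_eq_left this] at ih
      exact (min_le_left _ _).trans (by linarith)
    · have : (B : ℝ) ≤ tokens (S.history N π ω T) := by exact_mod_cast not_lt.mp hlt
      rw [min_eq_right this] at ih
      exact (min_le_right _ _).trans (by linarith)

/-- The last round played starts below `B` tokens and yields at most `N + 1`, so the overshoot is at
most `N`. -/
theorem sum_gain_le (π : Policy K) (B : ℕ) (ω : Ω) (T : ℕ) :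
    ∑ t ∈ Finset.range T, S.gain N π B t ω
      ≤ min (tokens (S.history N π ω T) : ℝ) (B + N) := by
  induction T with
  | zero =>
    simp only [Finset.range_zero, Finset.sum_empty]
    exact le_min (Nat.cast_nonneg _) (by positivity)
  | succ T ih =>
    have h1 := nAcc_le (S := S) (N := N) (π (S.history N π ω T)) (tokens (S.history N π ω T)) ω
    have h2 := tokens_history_succ (S := S) (N := N) π ω T
    obtain ⟨h3, h4⟩ := le_min_iff.mp ih
    rw [Finset.sum_range_succ]
    have h5 : (tokens (S.history N π ω T) : ℝ) ≤ tokens (S.history N π ω (T + 1)) := by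
      exact_mod_cast (by omega)
    by_cases hlt : tokens (S.history N π ω T) < B
    · have h6 : (tokens (S.history N π ω (T + 1)) : ℝ) ≤ B + N := by exact_mod_cast (by omega)
      have h7 : S.gain N π B T ω = tokens (S.history N π ω (T + 1)) - tokens (S.history N π ω T) := by
        rw [gain, running, if_pos hlt, one_mul]
      exact le_min (by linarith) (by linarith)
    · have h7 : S.gain N π B T ω = 0 := by rw [gain, running, if_neg hlt, zero_mul]
      exact le_min (by linarith) (by linarith)

/-- `dropLast` recovers the previous history, so the gain becomes a function of one history and the
Markov property applies. -/
theorem gain_eq (π : Policy K) (B t : ℕ) (ω : Ω) : S.gain N π B t ω =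
    (fun H : History K => running B H.dropLast * ((tokens H : ℝ) - tokens H.dropLast))
      (S.history N π ω (t + 1)) := by
  rw [history_succ, gain, history_succ]
  simp

/-- Expected number of tokens generated in the round after the history `H`, if it is played. -/
noncomputable def meanGain (S : SpecSampling K V Ω) (P : Measure Ω) (N : ℕ) (π : Policy K) (B : ℕ)
    (H : History K) : ℝ :=
  running B H * (1 + N * S.meanBE N P (π H))

variable [Fintype V] [IsProbabilityMeasure P]

theorem IsSpecSampling.integrable_running (h : S.IsSpecSampling P) (π : Policy K) (B t : ℕ) :
    Integrable (fun ω => running B (S.history N π ω t)) P := h.integrable_history π t (running B)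

theorem IsSpecSampling.expRounds_zero_eq (h : S.IsSpecSampling P) (π : Policy K) (B : ℕ) :
    S.expRounds P N 0 π B
      = ∑ t ∈ Finset.range B, ∫ ω, running B (S.history N π ω t) ∂P := by
  unfold expRounds
  simp_rw [rounds_zero_eq_sum]
  exact integral_finsetSum _ fun t _ => h.integrable_running π B t

theorem IsSpecSampling.expRounds_le_add (h : S.IsSpecSampling P) (m : ℕ) (π : Policy K) (B : ℕ) :
    S.expRounds P N m π B ≤ m + S.expRounds P N 0 π B := by
  have hi : Integrable (fun ω => (S.rounds N 0 π B ω : ℝ)) P := by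
    simp_rw [rounds_zero_eq_sum]
    exact integrable_finsetSum _ fun t _ => h.integrable_running π B t
  have h1 : ∫ ω, ((m : ℝ) + S.rounds N 0 π B ω) ∂P = m + S.expRounds P N 0 π B := by
    rw [integral_add (integrable_const _) hi]
    simp [expRounds]
  rw [← h1]
  -- Only the larger side must be integrable, so measurability of the rounds with minimum `m` is not
  -- needed.
  exact integral_mono_of_nonneg (ae_of_all _ fun ω => Nat.cast_nonneg _)
    ((integrable_const _).add hi)
    (ae_of_all _ fun ω => by
      have := rounds_le_add (S := S) (N := N) m π B ω
      beta_reduce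
      exact_mod_cast this)

theorem IsSpecSampling.integral_nAcc_add_one (h : S.IsSpecSampling P) (hN : 1 ≤ N) (i : Fin K) :
    ∫ ω, ((S.nAcc N i 0 ω : ℝ) + 1) ∂P = 1 + N * S.meanBE N P i := by
  have hN0 : (N : ℝ) ≠ 0 := by exact_mod_cast (by omega : N ≠ 0)
  rw [integral_add (h.integrable_comp_nAcc i 0 fun n => (n : ℝ)) (integrable_const _), meanBE]
  simp only [rBE, integral_div, integral_const, probReal_univ, one_smul]
  field_simp
  ring

theorem IsStationary.integral_gain (hst : S.IsStationary P ν) (h : S.IsSpecSampling P)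
    (hN : 1 ≤ N) (π : Policy K) (B t : ℕ) :
    ∫ ω, S.gain N π B t ω ∂P = ∫ ω, S.meanGain P N π B
      (S.history N π ω t) ∂P := by
  simp_rw [gain_eq]
  rw [hst.integral_history_succ h π t
    (fun H : History K => running B H.dropLast * ((tokens H : ℝ) - tokens H.dropLast))]
  refine integral_congr_ae (ae_of_all _ fun ω => ?_)
  simp only [meanGain, stepMean, List.dropLast_concat, tokens_append]
  rw [← h.integral_nAcc_add_one hN, ← integral_const_mul]
  refine integral_congr_ae (ae_of_all _ fun ω' => ?_)
  push_cast
  ring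

theorem IsSpecSampling.integrable_gain (h : S.IsSpecSampling P) (π : Policy K) (B t : ℕ) :
    Integrable (S.gain N π B t) P := by
  rw [funext (gain_eq (S := S) (N := N) π B t)]
  exact h.integrable_history π (t + 1)
    (fun H => running B H.dropLast * ((tokens H : ℝ) - tokens H.dropLast))

theorem IsSpecSampling.le_sum_integral_gain (h : S.IsSpecSampling P) (π : Policy K) (B : ℕ) :
    (B : ℝ) ≤ ∑ t ∈ Finset.range B, ∫ ω, S.gain N π B t ω ∂P := by
  rw [← integral_finsetSum _ fun t _ => h.integrable_gain π B t]
  have h1 : ∫ _, (B : ℝ) ∂P = B := by simp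
  rw [← h1]
  refine integral_mono (integrable_const _) (integrable_finsetSum _ fun t _ =>
    h.integrable_gain π B t) fun ω => ?_
  refine le_trans ?_ (min_le_sum_gain π B ω B)
  exact le_min (Nat.cast_le.mpr (le_tokens_history π ω B)) le_rfl

theorem IsSpecSampling.sum_integral_gain_le (h : S.IsSpecSampling P) (π : Policy K) (B : ℕ) :
    ∑ t ∈ Finset.range B, ∫ ω, S.gain N π B t ω ∂P ≤ B + N := by
  rw [← integral_finsetSum _ fun t _ => h.integrable_gain π B t]
  have h1 : ∫ _, ((B : ℝ) + N) ∂P = B + N := by simp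
  rw [← h1]
  exact integral_mono (integrable_finsetSum _ fun t _ => h.integrable_gain π B t)
    (integrable_const _) fun ω => (sum_gain_le π B ω B).trans (min_le_right _ _)

/-- Lower bound on the expected number of rounds of any policy. -/
theorem IsStationary.le_mul_expRounds (hst : S.IsStationary P ν) (h : S.IsSpecSampling P)
    (hN : 1 ≤ N) {istar : Fin K} (hmax : ∀ i, S.meanBE N P i ≤ S.meanBE N P istar)
    (π : Policy K) (B : ℕ) :
    (B : ℝ) ≤ (1 + N * S.meanBE N P istar) * S.expRounds P N 0 π B := by
  -- Wald's argument: at least `B` tokens are gained in expectation, and each played round has mean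
  -- gain at most `1 + N μ⋆`.
  refine (h.le_sum_integral_gain (N := N) π B).trans ?_
  rw [h.expRounds_zero_eq, Finset.mul_sum]
  refine Finset.sum_le_sum fun t _ => ?_
  rw [hst.integral_gain h hN, ← integral_const_mul]
  refine integral_mono (h.integrable_history π t (S.meanGain P N π B)) ((h.integrable_running π B t).const_mul _)
    fun ω => ?_
  rw [meanGain, mul_comm (1 + N * S.meanBE N P istar)]
  exact mul_le_mul_of_nonneg_left (by have := hmax (π (S.history N π ω t)); gcongr)
    (running_nonneg _ _)

/-- Decomposition of the expected number of rounds by the uses of suboptimal drafters. -/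
theorem IsStationary.mul_expRounds_le (hst : S.IsStationary P ν) (h : S.IsSpecSampling P)
    (hN : 1 ≤ N) {istar : Fin K} (hmax : ∀ i, S.meanBE N P i ≤ S.meanBE N P istar)
    (π : Policy K) (B : ℕ) :
    (1 + N * S.meanBE N P istar) * S.expRounds P N 0 π B ≤ B + N
      + ∑ i ∈ Finset.univ.erase istar, N * (S.meanBE N P istar - S.meanBE N P i) *
        ∑ t ∈ Finset.range B, ∫ ω, (if π (S.history N π ω t) = i then (1 : ℝ) else 0) ∂P := by
  have hu : ∀ i t, Integrable (fun ω => if π (S.history N π ω t) = i then (1 : ℝ) else 0) P :=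
    fun i t => h.integrable_history π t (fun H => if π H = i then (1 : ℝ) else 0)
  have h1 : ∀ t ∈ Finset.range B, (1 + N * S.meanBE N P istar) *
      ∫ ω, running B (S.history N π ω t) ∂P ≤ ∫ ω, S.gain N π B t ω ∂P
        + ∑ i ∈ Finset.univ.erase istar, N * (S.meanBE N P istar - S.meanBE N P i) *
          ∫ ω, (if π (S.history N π ω t) = i then (1 : ℝ) else 0) ∂P := by
    intro t _
    have hs : Integrable (fun ω => ∑ i ∈ Finset.univ.erase istar,
        N * (S.meanBE N P istar - S.meanBE N P i) *
          (if π (S.history N π ω t) = i then (1 : ℝ) else 0)) P :=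
      integrable_finsetSum _ fun i _ => (hu i t).const_mul _
    have h2 : ∑ i ∈ Finset.univ.erase istar, N * (S.meanBE N P istar - S.meanBE N P i) *
          ∫ ω, (if π (S.history N π ω t) = i then (1 : ℝ) else 0) ∂P
        = ∫ ω, ∑ i ∈ Finset.univ.erase istar, N * (S.meanBE N P istar - S.meanBE N P i) *
          (if π (S.history N π ω t) = i then (1 : ℝ) else 0) ∂P := by
      rw [integral_finsetSum _ fun i _ => (hu i t).const_mul _]
      exact Finset.sum_congr rfl fun i _ => (integral_const_mul _ _).symm
    have hg : Integrable (fun ω => S.meanGain P N π B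
      (S.history N π ω t)) P := h.integrable_history π t (S.meanGain P N π B)
    rw [hst.integral_gain h hN, h2, ← integral_add hg hs, ← integral_const_mul]
    refine integral_mono ((h.integrable_running π B t).const_mul _) (hg.add hs) fun ω => ?_
    beta_reduce
    set H := S.history N π ω t
    have hd : ∀ i, 0 ≤ N * (S.meanBE N P istar - S.meanBE N P i) := fun i =>
      mul_nonneg (Nat.cast_nonneg _) (sub_nonneg.mpr (hmax i))
    -- Loss of the round against the best drafter. The sum over suboptimal drafters selects the one
    -- in use; counting it even after the target is reached only enlarges the bound.
    have h3 : N * (S.meanBE N P istar - S.meanBE N P (π H)) ≤ ∑ i ∈ Finset.univ.erase istar,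
        N * (S.meanBE N P istar - S.meanBE N P i) * (if π H = i then (1 : ℝ) else 0) := by
      by_cases hi : π H = istar
      · rw [hi, sub_self, mul_zero]
        exact Finset.sum_nonneg fun i _ => mul_nonneg (hd i) (by split_ifs <;> norm_num)
      · have := Finset.single_le_sum (s := Finset.univ.erase istar)
          (f := fun i => N * (S.meanBE N P istar - S.meanBE N P i) *
            (if π H = i then (1 : ℝ) else 0))
          (fun i _ => mul_nonneg (hd i) (by split_ifs <;> norm_num))
          (Finset.mem_erase.mpr ⟨hi, Finset.mem_univ _⟩)
        simpa using this
    have h4 := hd (π H)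
    unfold meanGain running
    split_ifs <;> linarith
  have h3 := Finset.sum_le_sum h1
  rw [← Finset.mul_sum, ← h.expRounds_zero_eq, Finset.sum_add_distrib, Finset.sum_comm] at h3
  simp_rw [← Finset.mul_sum] at h3
  have h4 := h.sum_integral_gain_le (N := N) π B
  linarith

/-- Regret of MetaSD-UCB with the BE reward. -/
theorem IsStationary.regretUCB_le (hst : S.IsStationary P ν) (h : S.IsSpecSampling P)
    (hK : 2 ≤ K) (hN : 1 ≤ N) {istar : Fin K}
    (hgap : ∀ i, i ≠ istar → S.meanBE N P i < S.meanBE N P istar)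
    {β : ℝ} (hβ : 1 ≤ β) {π : Policy K} (hπ : IsMetaSDUCB N β π) {B : ℕ} (hB : 1 ≤ B) :
    S.regretUCB P N π B ≤ K + N + ∑ i ∈ Finset.univ.erase istar,
      (8 * β ^ 2 / (S.meanBE N P istar - S.meanBE N P i) ^ 2 * Real.log B + (K + 3)) := by
  have hmax : ∀ i, S.meanBE N P i ≤ S.meanBE N P istar := fun i => by
    rcases eq_or_ne i istar with rfl | hi
    · exact le_rfl
    · exact (hgap i hi).le
  have hmean0 : ∀ i, 0 ≤ S.meanBE N P i := fun i => integral_nonneg fun ω => (rBE_mem i 0 ω).1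
  set c := 1 + N * S.meanBE N P istar with hc
  have hc1 : 1 ≤ c := by
    have := mul_nonneg (Nat.cast_nonneg (α := ℝ) N) (hmean0 istar)
    linarith
  have hc0 : 0 < c := by linarith
  have h1 : (B : ℝ) / c ≤ ⨅ π' : Policy K, S.expRounds P N 0 π' B := by
    have : Nonempty (Policy K) := ⟨π⟩
    refine le_ciInf fun π' => ?_
    rw [div_le_iff₀ hc0, mul_comm]
    exact hst.le_mul_expRounds h hN hmax π' B
  have h2 : c * S.expRounds P N 0 π B ≤ c * (B / c + N + ∑ i ∈ Finset.univ.erase istar,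
      (8 * β ^ 2 / (S.meanBE N P istar - S.meanBE N P i) ^ 2 * Real.log B + (K + 3))) := by
    refine (hst.mul_expRounds_le h hN hmax π B).trans ?_
    rw [mul_add, mul_add, mul_div_cancel₀ _ hc0.ne', Finset.mul_sum]
    refine add_le_add (add_le_add le_rfl (le_mul_of_one_le_left (Nat.cast_nonneg _) hc1))
      (Finset.sum_le_sum fun i hi => ?_)
    have hi' := Finset.ne_of_mem_erase hi
    -- `N (μ⋆ - μ_i) ≤ c` because `μ_i ≥ 0`: a suboptimal use costs at most one extra round.
    refine mul_le_mul ?_ (hst.integral_sum_use_le h hK hβ hπ (hgap i hi') hB)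
      (Finset.sum_nonneg fun t _ => integral_nonneg fun ω => ?_) hc0.le
    · rw [hc, mul_sub]
      have := mul_nonneg (Nat.cast_nonneg (α := ℝ) N) (hmean0 i)
      linarith
    · simp only [Pi.zero_apply]
      split_ifs <;> norm_num
  have h3 := le_of_mul_le_mul_left h2 hc0
  have h4 := h.expRounds_le_add (N := N) K π B
  unfold regretUCB
  linarith

end SpecSampling

/-! ### Mean and variance of the block efficiency -/

theorem sum_Icc_one_eq_range (n : ℕ) (f : ℕ → ℝ) :
    ∑ s ∈ Finset.Icc 1 n, f s = ∑ s ∈ Finset.range n, f (s + 1) := by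
  rw [Finset.range_eq_Ico, Finset.sum_Ico_add' f 0 n 1]
  congr 1

theorem one_sub_mul_sum_pow (n : ℕ) (x : ℝ) :
    (1 - x) * ∑ s ∈ Finset.range n, x ^ (s + 1) = x - x ^ (n + 1) := by
  induction n with
  | zero => simp
  | succ n ih => rw [Finset.sum_range_succ, mul_add, ih]; ring

theorem sum_mul_pow_two_mul_sub_succ (n : ℕ) (x : ℝ) :
    ∑ s ∈ Finset.Icc 1 (n + 1), (s : ℝ) * x ^ (2 * (n + 1) - s)
      = x ^ 2 * ∑ s ∈ Finset.Icc 1 n, (s : ℝ) * x ^ (2 * n - s) + (n + 1) * x ^ (n + 1) := by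
  rw [Finset.sum_Icc_succ_top (by omega), Finset.mul_sum]
  congr 1
  · refine Finset.sum_congr rfl fun s hs => ?_
    have := (Finset.mem_Icc.mp hs).2
    rw [show 2 * (n + 1) - s = 2 * n - s + 2 by omega, pow_add]
    ring
  · rw [show 2 * (n + 1) - (n + 1) = n + 1 by omega]
    push_cast
    ring

/-- Multiplying by `1 - x` keeps the closed form polynomial, so the variance identity can be proved
by induction with `linear_combination` and no division. -/
theorem one_sub_mul_sum_mul_pow (n : ℕ) (x : ℝ) :
    (1 - x) * ∑ s ∈ Finset.Icc 1 n, (s : ℝ) * x ^ (2 * n - s)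
      = n * x ^ n - x ^ n * ∑ s ∈ Finset.range n, x ^ (s + 1) := by
  induction n with
  | zero => simp
  | succ n ih =>
    have h1 := one_sub_mul_sum_pow n x
    rw [sum_mul_pow_two_mul_sub_succ, Finset.sum_range_succ]
    push_cast
    linear_combination x ^ 2 * ih + x ^ (n + 1) * h1

theorem hFun_eq_sub (n : ℕ) (x : ℝ) :
    hFun n x = gFun n x - ∑ s ∈ Finset.Icc 1 n, (s : ℝ) * x ^ (2 * n - s) := by
  simp only [hFun, gFun, mul_sub, Finset.sum_sub_distrib]

/-- The variance of the number of accepted tokens. -/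
theorem sum_sub_sq_eq_mul_hFun (n : ℕ) (x : ℝ) :
    ∑ s ∈ Finset.range n, (2 * (s : ℝ) + 1) * x ^ (s + 1)
      - (∑ s ∈ Finset.range n, x ^ (s + 1)) ^ 2 = x * hFun n x := by
  induction n with
  | zero => simp [hFun]
  | succ n ih =>
    have h1 := one_sub_mul_sum_pow n x
    have h2 := one_sub_mul_sum_mul_pow n x
    rw [hFun_eq_sub] at ih
    rw [hFun_eq_sub, sum_mul_pow_two_mul_sub_succ, Finset.sum_range_succ, Finset.sum_range_succ]
    have h3 : gFun (n + 1) x = gFun n x + (n + 1) * x ^ n := by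
      unfold gFun
      rw [Finset.sum_Icc_succ_top (by omega)]
      simp
    rw [h3]
    linear_combination ih - x * (1 + x) * h2 - x ^ (n + 1) * h1

/-- The convex power lies above its tangent at `x`; summed over `s` this is `f_n(x) - f_n(y) ≤
g_n(x) (x - y)`. -/
theorem pow_succ_sub_pow_succ_le {x y : ℝ} (hy : 0 ≤ y) (hyx : y ≤ x) (s : ℕ) :
    x ^ (s + 1) - y ^ (s + 1) ≤ (s + 1) * x ^ s * (x - y) := by
  induction s with
  | zero => simp
  | succ s ih =>
    have hx : 0 ≤ x := hy.trans hyx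
    have h1 := mul_le_mul_of_nonneg_left ih hx
    have h2 : y ^ (s + 1) * (x - y) ≤ x ^ (s + 1) * (x - y) :=
      mul_le_mul_of_nonneg_right (pow_le_pow_left₀ hy hyx _) (by linarith)
    push_cast
    have e1 : x ^ (s + 1 + 1) - y ^ (s + 1 + 1)
        = x * (x ^ (s + 1) - y ^ (s + 1)) + y ^ (s + 1) * (x - y) := by ring
    have e2 : ((s : ℝ) + 1 + 1) * x ^ (s + 1) * (x - y)
        = x * ((s + 1) * x ^ s * (x - y)) + x ^ (s + 1) * (x - y) := by ring
    rw [e1, e2]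
    linarith

/-- The variance condition keeps the acceptance rate away from `1`. -/
theorem le_one_sub_of_hFun_ge {N : ℕ} (hN : 1 ≤ N) {x : ℝ} (hx : x ∈ Set.Ioo (0 : ℝ) 1)
    (hh : hFun N x ≥ gFun N x ^ 2 / (4 * N * x)) : x ≤ 1 - 1 / (8 * (N : ℝ) ^ 4) := by
  obtain ⟨hx0, hx1⟩ := hx
  have hN0 : (0 : ℝ) < N := by exact_mod_cast hN
  have hg : 1 ≤ gFun N x := by
    have := Finset.single_le_sum (s := Finset.Icc 1 N) (f := fun s : ℕ => (s : ℝ) * x ^ (s - 1))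
      (fun s _ => by positivity) (Finset.mem_Icc.mpr ⟨le_rfl, hN⟩)
    simpa [gFun] using this
  have h1 : 1 / (4 * (N : ℝ)) ≤ hFun N x := by
    refine le_trans ?_ hh
    rw [div_le_div_iff₀ (by positivity) (by positivity)]
    have h2 : 1 ≤ gFun N x ^ 2 := one_le_pow₀ hg
    nlinarith
  -- Each bracket is at most `1 - x ^ (2 * N) ≤ 2 N (1 - x)`, by Bernoulli. Against `h1` this forces
  -- `1 - x ≥ 1 / (8 N ^ 4)`.
  have h2 : hFun N x ≤ 2 * N ^ 3 * (1 - x) := by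
    have hb : 1 - (2 * N : ℕ) * (1 - x) ≤ x ^ (2 * N) := by
      have := one_add_mul_le_pow (a := x - 1) (by linarith) (2 * N)
      rw [show 1 + (x - 1) = x by ring] at this
      linarith
    have : ∀ s ∈ Finset.Icc 1 N, (s : ℝ) * (x ^ (s - 1) - x ^ (2 * N - s))
        ≤ N * (2 * N * (1 - x)) := by
      intro s hs
      have hsN : (s : ℝ) ≤ N := by exact_mod_cast (Finset.mem_Icc.mp hs).2
      have e1 : x ^ (s - 1) ≤ 1 := pow_le_one₀ hx0.le hx1.le
      have e2 : x ^ (2 * N) ≤ x ^ (2 * N - s) :=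
        pow_le_pow_of_le_one hx0.le hx1.le (Nat.sub_le _ _)
      push_cast at hb
      have e3 : x ^ (s - 1) - x ^ (2 * N - s) ≤ 2 * N * (1 - x) := by linarith
      calc _ ≤ (s : ℝ) * (2 * N * (1 - x)) := mul_le_mul_of_nonneg_left e3 (Nat.cast_nonneg _)
        _ ≤ _ := mul_le_mul_of_nonneg_right hsN (by have := sub_pos.mpr hx1; positivity)
    refine (Finset.sum_le_sum this).trans (le_of_eq ?_)
    rw [Finset.sum_const, Nat.card_Icc, nsmul_eq_mul, Nat.add_sub_cancel]
    ring
  have h3 : 1 / (8 * (N : ℝ) ^ 4) ≤ 1 - x := by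
    rw [div_le_iff₀ (by positivity)]
    rw [div_le_iff₀ (by positivity)] at h1
    calc (1 : ℝ) ≤ hFun N x * (4 * N) := h1
      _ ≤ (2 * N ^ 3 * (1 - x)) * (4 * N) := mul_le_mul_of_nonneg_right h2 (by positivity)
      _ = _ := by ring
  linarith

namespace SpecSampling

variable {K : ℕ} {V Ω : Type*} [Fintype V] [MeasurableSpace Ω]
  {P : Measure Ω} {S : SpecSampling K V Ω} {ν : Fin K → Measure ℝ} {N : ℕ}

theorem IsStationary.mean_nonneg (hst : S.IsStationary P ν) (h : S.IsSpecSampling P)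
    (i : Fin K) : 0 ≤ ∫ x, x ∂(ν i) := by
  rw [← hst.law i 0, integral_map (h.measurable_alpha i 0).aemeasurable (f := fun x : ℝ => x)
    aestronglyMeasurable_id]
  exact integral_nonneg fun ω => (h.alpha_mem i 0 ω).1

variable [IsProbabilityMeasure P]

theorem IsStationary.meanBE_eq (hst : S.IsStationary P ν) (h : S.IsSpecSampling P)
    (i : Fin K) :
    S.meanBE N P i = (∑ s ∈ Finset.range N, (∫ x, x ∂(ν i)) ^ (s + 1)) / N := by
  have := hst.integral_comp_nAcc (N := N) h i 0 (fun n => (n : ℝ) / N)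
  unfold meanBE rBE
  rw [this, Finset.sum_div]
  simp only [Nat.cast_zero, zero_div, zero_add]
  refine Finset.sum_congr rfl fun s _ => ?_
  push_cast
  ring

theorem IsStationary.varBE_eq (hst : S.IsStationary P ν) (h : S.IsSpecSampling P) (i : Fin K) :
    S.varBE N P i = (∫ x, x ∂(ν i)) * hFun N (∫ x, x ∂(ν i)) / N ^ 2 := by
  have hm : Measurable (S.rBE N i 0) :=
    (measurable_from_top.comp (h.measurable_nAcc i 0)).div_const _
  have hL : MemLp (S.rBE N i 0) 2 P := MemLp.of_bound hm.aestronglyMeasurable 1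
    (ae_of_all _ fun ω => by
      rw [Real.norm_eq_abs, abs_of_nonneg (rBE_mem i 0 ω).1]; exact (rBE_mem i 0 ω).2)
  have h2 : ∫ ω, (S.rBE N i 0 ^ 2) ω ∂P
      -- The weights are the increments `(s + 1) ^ 2 - s ^ 2`.
      = (∑ s ∈ Finset.range N, (2 * (s : ℝ) + 1) * (∫ x, x ∂(ν i)) ^ (s + 1)) / N ^ 2 := by
    have := hst.integral_comp_nAcc (N := N) h i 0 (fun n => ((n : ℝ) / N) ^ 2)
    simp only [Pi.pow_apply, rBE]
    rw [this, Finset.sum_div]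
    simp only [Nat.cast_zero, zero_div, ne_eq, OfNat.ofNat_ne_zero, not_false_eq_true, zero_pow,
      zero_add]
    refine Finset.sum_congr rfl fun s _ => ?_
    push_cast
    ring
  have h3 := hst.meanBE_eq (N := N) h i
  unfold meanBE at h3
  unfold varBE
  rw [variance_eq_sub hL, h2, h3, ← sum_sub_sq_eq_mul_hFun]
  ring

end SpecSampling

/-! ### Comparison of the two bounds -/

namespace SpecSampling

variable {K : ℕ} {V Ω : Type*} [Fintype V] [MeasurableSpace Ω]
  {P : Measure Ω} {S : SpecSampling K V Ω} {ν : Fin K → Measure ℝ} {N : ℕ}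
  [IsProbabilityMeasure P] {i j : Fin K}

theorem IsStationary.meanBE_lt (hst : S.IsStationary P ν) (h : S.IsSpecSampling P) (hN : 1 ≤ N)
    (hij : ∫ x, x ∂(ν i) < ∫ x, x ∂(ν j)) : S.meanBE N P i < S.meanBE N P j := by
  have hN0 : (0 : ℝ) < N := by exact_mod_cast hN
  rw [hst.meanBE_eq h, hst.meanBE_eq h]
  refine div_lt_div_of_pos_right ?_ hN0
  exact Finset.sum_lt_sum_of_nonempty (Finset.nonempty_range_iff.mpr (by omega)) fun s _ =>
    pow_lt_pow_left₀ hij (hst.mean_nonneg h i) (Nat.succ_ne_zero s)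

theorem IsStationary.meanBE_sub_le (hst : S.IsStationary P ν) (h : S.IsSpecSampling P)
    (hij : ∫ x, x ∂(ν i) ≤ ∫ x, x ∂(ν j)) :
    S.meanBE N P j - S.meanBE N P i
      ≤ gFun N (∫ x, x ∂(ν j)) * (∫ x, x ∂(ν j) - ∫ x, x ∂(ν i)) / N := by
  rw [hst.meanBE_eq h, hst.meanBE_eq h, ← sub_div, ← Finset.sum_sub_distrib, gFun,
    sum_Icc_one_eq_range, Finset.sum_mul]
  refine div_le_div_of_nonneg_right (Finset.sum_le_sum fun s _ => ?_) (Nat.cast_nonneg N)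
  have := pow_succ_sub_pow_succ_le (hst.mean_nonneg h i) hij s
  simpa using this

/-- As BE means are nonnegative, this bounds every BE gap by `α⋆`, as the iterated logarithm
requires. -/
theorem IsStationary.meanBE_le_mean (hst : S.IsStationary P ν) (h : S.IsSpecSampling P)
    (hN : 1 ≤ N) (hj : ∫ x, x ∂(ν j) ≤ 1) : S.meanBE N P j ≤ ∫ x, x ∂(ν j) := by
  have hN0 : (0 : ℝ) < N := by exact_mod_cast hN
  have h0 := hst.mean_nonneg h j
  rw [hst.meanBE_eq h, div_le_iff₀ hN0]
  refine (Finset.sum_le_card_nsmul _ _ (∫ x, x ∂(ν j)) fun s _ => ?_).trans (le_of_eq ?_)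
  · exact pow_le_of_le_one h0 hj (Nat.succ_ne_zero s)
  · rw [Finset.card_range, nsmul_eq_mul, mul_comm]

end SpecSampling

/-- The iterated logarithm in the regret bound is bounded below if the gaps stay away from `1`. -/
theorem neg_log_le_log_log_sum {ι : Type*} {s : Finset ι} {δ : ι → ℝ} {N : ℕ} (hN : 1 ≤ N)
    {i : ι} (hi : i ∈ s) (h0 : 0 < δ i) (h1 : δ i ≤ 1 - 1 / (8 * (N : ℝ) ^ 4)) :
    -Real.log (4 * (N : ℝ) ^ 4) ≤ Real.log (Real.log (∑ j ∈ s, 1 / δ j ^ 2)) := by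
  have hN0 : (0 : ℝ) < N := by exact_mod_cast hN
  have e1 : 1 / δ i ^ 2 ≤ ∑ j ∈ s, 1 / δ j ^ 2 :=
    Finset.single_le_sum (f := fun j => 1 / δ j ^ 2) (fun _ _ => by positivity) hi
  have e2 : Real.log (1 / δ i ^ 2) = -(2 * Real.log (δ i)) := by
    rw [one_div, Real.log_inv, Real.log_pow]
    norm_num
  have e3 : Real.log (δ i) ≤ δ i - 1 := Real.log_le_sub_one_of_pos h0
  have e4 : (4 * (N : ℝ) ^ 4)⁻¹ = 2 * (1 / (8 * (N : ℝ) ^ 4)) := by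
    field_simp
    norm_num
  -- One summand suffices: `ln (1 / δ ^ 2) = -2 ln δ ≥ 2 (1 - δ) ≥ 1 / (4 N ^ 4)`.
  have e5 : (4 * (N : ℝ) ^ 4)⁻¹ ≤ Real.log (∑ j ∈ s, 1 / δ j ^ 2) := by
    refine le_trans ?_ (Real.log_le_log (by positivity) e1)
    rw [e2, e4]
    linarith
  rw [← Real.log_inv]
  exact Real.log_le_log (by positivity) e5

theorem sum_mul_log_add_le_regretBound {K : ℕ} {istar : Fin K} {c Δ : Fin K → ℝ} {C' C : ℝ}
    (hc : ∀ i, 0 ≤ c i)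
    (hL : 0 ≤ Real.log (Real.log (∑ j ∈ Finset.univ.erase istar, 1 / Δ j ^ 2)) + C') (B : ℕ) :
    ∑ i ∈ Finset.univ.erase istar, c i * Real.log B + C ≤ regretBound istar c Δ C' C B := by
  unfold regretBound
  refine add_le_add (Finset.sum_le_sum fun i _ => ?_) le_rfl
  exact mul_le_mul_of_nonneg_left (by linarith) (hc i)

/-- The total coefficient of `ln B` is strictly larger on the right, so the difference tends to
infinity whatever the constants. -/
theorem eventually_regretBound_lt {K : ℕ} {istar : Fin K} {c c' Δ Δ' : Fin K → ℝ}
    (hne : (Finset.univ.erase istar).Nonempty) (hcc : ∀ i, i ≠ istar → c i < c' i)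
    (D' D C' C : ℝ) :
    ∀ᶠ B : ℕ in atTop, regretBound istar c Δ D' D B < regretBound istar c' Δ' C' C B := by
  set L := Real.log (Real.log (∑ j ∈ Finset.univ.erase istar, 1 / Δ j ^ 2))
  set L' := Real.log (Real.log (∑ j ∈ Finset.univ.erase istar, 1 / Δ' j ^ 2))
  set A := ∑ i ∈ Finset.univ.erase istar, c i with hA
  set A' := ∑ i ∈ Finset.univ.erase istar, c' i with hA'
  have hlt : A < A' := Finset.sum_lt_sum_of_nonempty hne fun i hi =>
    hcc i (Finset.ne_of_mem_erase hi)
  have ht : Tendsto (fun B : ℕ => (A' - A) * Real.log B) atTop atTop :=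
    (Real.tendsto_log_atTop.comp tendsto_natCast_atTop_atTop).const_mul_atTop (sub_pos.mpr hlt)
  filter_upwards [ht.eventually_gt_atTop (A * (L + D') + D - (A' * (L' + C') + C))] with B hB
  unfold regretBound
  rw [← Finset.sum_mul, ← Finset.sum_mul]
  change A * (Real.log B + L + D') + D < A' * (Real.log B + L' + C') + C
  linarith

end MetaSD

/-! ### Proof of the claim -/

theorem corollary1 (K N : ℕ) (hK : 2 ≤ K) (hN : 1 ≤ N) :
    ∃ C' > (0 : ℝ), ∃ C > (0 : ℝ),
      ∀ (V Ω : Type*) [Fintype V] [MeasurableSpace Ω] (P : MeasureTheory.Measure Ω)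
        [MeasureTheory.IsProbabilityMeasure P]
        (S : MetaSD.SpecSampling K V Ω) (ν : Fin K → MeasureTheory.Measure ℝ)
        (α : Fin K → ℝ) (istar : Fin K),
        S.IsSpecSampling P →
        S.IsStationary P ν →
        (∀ i, α i = ∫ x, x ∂(ν i)) →
        (∀ i, α i ≤ α istar) →
        α istar ∈ Set.Ioo (0 : ℝ) 1 →
        MetaSD.hFun N (α istar) ≥ MetaSD.gFun N (α istar) ^ 2 / (4 * N * α istar) →
        (∀ i, i ≠ istar → S.varBE N P i < S.varBE N P istar) →
        ∀ Δ ΔBE cBE cBD : Fin K → ℝ,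
          (∀ i, Δ i = α istar - α i) →
          (∀ i, ΔBE i = S.meanBE N P istar - S.meanBE N P i) →
          (∀ i, cBE i = (32 * S.varBE N P istar + 16) / ΔBE i ^ 2) →
          (∀ i, cBD i = 8 / (N * Δ i ^ 2)) →
          -- the bound holds for the regret of MetaSD-UCB with the BE reward
          (∀ π : MetaSD.Policy K,
            MetaSD.IsMetaSDUCB N (Real.sqrt (4 * S.varBE N P istar + 2)) π →
            ∀ B : ℕ, 1 ≤ B →
              S.regretUCB P N π B ≤ MetaSD.regretBound istar cBE ΔBE C' C B) ∧
          -- its leading term is strictly larger, drafter by drafter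
          (∀ i, i ≠ istar → 0 < Δ i ∧ 0 < ΔBE i ∧ cBD i < cBE i) ∧
          -- the bound exceeds the leading term of the bound for the BD reward
          (∀ B : ℕ, 1 ≤ B →
            ∑ i ∈ Finset.univ.erase istar, cBD i * Real.log B
              < MetaSD.regretBound istar cBE ΔBE C' C B) ∧
          -- whatever its constants, the bound for the BD reward is smaller for large `B`
          (∀ D' D : ℝ, ∀ᶠ B : ℕ in Filter.atTop,
            MetaSD.regretBound istar cBD Δ D' D B
              < MetaSD.regretBound istar cBE ΔBE C' C B) := by
  have hN0 : (0 : ℝ) < N := by exact_mod_cast hN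
  have hN4 : (1 : ℝ) ≤ 4 * (N : ℝ) ^ 4 := by
    have : (1 : ℝ) ≤ (N : ℝ) ^ 4 := one_le_pow₀ (by exact_mod_cast hN)
    linarith
  -- `C'` offsets the lower bound `-ln (4 N ^ 4)` of the iterated logarithm. `C` collects the `K`
  -- initial rounds, the overshoot `N`, and `K + 3` for each of at most `K` suboptimal drafters; the
  -- rest is slack.
  refine ⟨1 + Real.log (4 * (N : ℝ) ^ 4), by linarith [Real.log_nonneg hN4],
    K + N + K * (K + 3) + 1, by positivity, ?_⟩
  intro V Ω _ _ P _ S ν α istar h hst hα hmax hα01 hh hvar Δ ΔBE cBE cBD hΔ hΔBE hcBE hcBD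
  obtain ⟨hα0, hα1⟩ := hα01
  -- The variance depends on the drafter only through `α_i`, so a tie in `α` would contradict the
  -- strict inequality of variances.
  have hαlt : ∀ i, i ≠ istar → α i < α istar := fun i hi => by
    refine lt_of_le_of_ne (hmax i) fun he => (hvar i hi).ne ?_
    rw [hst.varBE_eq h, hst.varBE_eq h, ← hα, ← hα, he]
  have hgap : ∀ i, i ≠ istar → S.meanBE N P i < S.meanBE N P istar := fun i hi =>
    hst.meanBE_lt h hN (by rw [← hα, ← hα]; exact hαlt i hi)
  set v := S.varBE N P istar with hv
  have hv0 : 0 ≤ v := variance_nonneg _ _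
  -- The hypothesis on `hFun`, cleared of denominators, with `α⋆ h_N(α⋆) = N ^ 2 v`.
  have hg : MetaSD.gFun N (α istar) ^ 2 ≤ 4 * N ^ 3 * v := by
    rw [ge_iff_le, div_le_iff₀ (by positivity)] at hh
    refine hh.trans (le_of_eq ?_)
    rw [hv, hst.varBE_eq h, ← hα]
    field_simp
  have hΔpos : ∀ i, i ≠ istar → 0 < Δ i := fun i hi => by
    rw [hΔ]; exact sub_pos.mpr (hαlt i hi)
  have hΔBEpos : ∀ i, i ≠ istar → 0 < ΔBE i := fun i hi => by
    rw [hΔBE]; exact sub_pos.mpr (hgap i hi)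
  have hcc : ∀ i, i ≠ istar → cBD i < cBE i := by
    intro i hi
    have h1 := hΔpos i hi
    have h2 := hΔBEpos i hi
    have h3 : ΔBE i ≤ MetaSD.gFun N (α istar) * Δ i / N := by
      rw [hΔBE, hΔ, hα istar, hα i]
      exact hst.meanBE_sub_le h (by rw [← hα, ← hα]; exact hmax i)
    have h4 : ΔBE i ^ 2 ≤ 4 * N * v * Δ i ^ 2 := by
      calc ΔBE i ^ 2 ≤ (MetaSD.gFun N (α istar) * Δ i / N) ^ 2 := pow_le_pow_left₀ h2.le h3 2
        _ = MetaSD.gFun N (α istar) ^ 2 * (Δ i ^ 2 / N ^ 2) := by ring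
        _ ≤ 4 * N ^ 3 * v * (Δ i ^ 2 / N ^ 2) := mul_le_mul_of_nonneg_right hg (by positivity)
        _ = _ := by field_simp
    -- By `h4`, `8 ΔBE ^ 2 ≤ 32 v N Δ ^ 2`; the summand `16` in the numerator makes the comparison
    -- strict.
    rw [hcBD, hcBE, div_lt_div_iff₀ (by positivity) (by positivity)]
    have h5 : 0 < N * Δ i ^ 2 := by positivity
    linarith
  have hcBE0 : ∀ i, 0 ≤ cBE i := fun i => by rw [hcBE]; positivity
  have : Nontrivial (Fin K) := Fin.nontrivial_iff_two_le.mpr hK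
  obtain ⟨i₀, hi₀⟩ := exists_ne istar
  have hmem : i₀ ∈ Finset.univ.erase istar := Finset.mem_erase.mpr ⟨hi₀, Finset.mem_univ _⟩
  have hmean0 : ∀ i, 0 ≤ S.meanBE N P i := fun i =>
    MeasureTheory.integral_nonneg fun ω => (MetaSD.SpecSampling.rBE_mem i 0 ω).1
  have hL : 0 ≤ Real.log (Real.log (∑ j ∈ Finset.univ.erase istar, 1 / ΔBE j ^ 2))
      + (1 + Real.log (4 * (N : ℝ) ^ 4)) := by
    have h1 := hst.meanBE_le_mean (N := N) (j := istar) h hN (by rw [← hα]; exact hα1.le)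
    rw [← hα] at h1
    have h2 := MetaSD.le_one_sub_of_hFun_ge hN ⟨hα0, hα1⟩ hh
    have h3 := MetaSD.neg_log_le_log_log_sum hN hmem (hΔBEpos i₀ hi₀)
      (by rw [hΔBE]; linarith [hmean0 i₀])
    linarith
  have hlb := MetaSD.sum_mul_log_add_le_regretBound (C := K + N + K * (K + 3) + 1) hcBE0 hL
  refine ⟨fun π hπ B hB => ?_, fun i hi => ⟨hΔpos i hi, hΔBEpos i hi, hcc i hi⟩, fun B hB => ?_,
    fun D' D => MetaSD.eventually_regretBound_lt ⟨i₀, hmem⟩ hcc D' D _ _⟩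
  · refine le_trans ?_ (hlb B)
    refine (hst.regretUCB_le h hK hN hgap (Real.one_le_sqrt.mpr (by linarith)) hπ hB).trans ?_
    rw [Real.sq_sqrt (by linarith), Finset.sum_add_distrib, Finset.sum_const, nsmul_eq_mul]
    -- The choice `β ^ 2 = 4 v + 2` turns `8 β ^ 2` into `32 v + 16`.
    have h1 : ∀ i, 8 * (4 * v + 2) / (S.meanBE N P istar - S.meanBE N P i) ^ 2 = cBE i := fun i => by
      rw [hcBE, hΔBE]
      congr 1
      ring
    simp_rw [h1]
    have h2 : (((Finset.univ.erase istar).card : ℕ) : ℝ) ≤ K := by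
      have := Finset.card_le_univ (Finset.univ.erase istar)
      rw [Fintype.card_fin] at this
      exact_mod_cast this
    have h3 := mul_le_mul_of_nonneg_right h2 (by positivity : (0 : ℝ) ≤ K + 3)
    linarith
  · refine lt_of_lt_of_le ?_ (hlb B)
    have h1 : ∑ i ∈ Finset.univ.erase istar, cBD i * Real.log B
        ≤ ∑ i ∈ Finset.univ.erase istar, cBE i * Real.log B :=
      Finset.sum_le_sum fun i hi => mul_le_mul_of_nonneg_right
        (hcc i (Finset.ne_of_mem_erase hi)).le (Real.log_nonneg (by exact_mod_cast hB))
    have h2 : (0 : ℝ) < K + N + K * (K + 3) + 1 := by positivity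
    linarith
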